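/- Notation. $\hat{\mathbb C}=\mathbb C\cup\{\infty\}$, $\mathbb D=\{|z|<1\}$, $\theta(z)=1/\bar z$, $k(z)=\ln\frac1{|z|}\,\mathbf 1_{|z|\ge 1}$, and $Q\in\mathbb R$. Fields are random generalized functions $\phi$ on $\hat{\mathbb C}$, given by their pairings $\int\phi f$ with the smooth real densities $f(z)\,d^2z$ on $\hat{\mathbb C}$. For $A\subset\mathbb C$, $\mathcal F_A$ is the $\sigma$-algebra generated by the pairings with $\operatorname{supp} f\subset A$. Let $\Phi$ be the centred Gaussian field on $\hat{\mathbb C}$ with covariance $\ln\frac1{|z-w|}-k(z)-k(w)$, let $\Phi_{\mathbb D}$ be the Dirichlet Gaussian free field on $\mathbb D$, with covariance $\ln\frac{|1-z\bar w|}{|z-w|}$ on $\mathbb D\times\mathbb D$ (zero elsewhere), and let $\mathbb E_{\mathbb D}$ be the expectation over $\Phi_{\mathbb D}$. Let $d\mathbb P(\varphi)=\prod_{n>0}\frac1{2\pi}e^{-\frac12(\alpha_n^2+\beta_n^2)}d\alpha_n\,d\beta_n$, $\varphi_n=\overline{\varphi_{-n}}=\frac{1}{2\sqrt n}(\alpha_n+i\beta_n)$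 for $n>0$, and let $P\varphi$ be the harmonic extension $(P\varphi)(z)=\sum_{n>0}(\varphi_n\bar z^n+\varphi_{-n}z^n)$ for $|z|<1$, $(P\varphi)(z)=(P\varphi)(1/\bar z)$ for $|z|\geq1$. Put $$\langle F\rangle=\int_{\mathbb R}dc\,e^{-2Qc}\,\mathbb E\,F(c+\Phi+2Qk),\qquad (\Theta F)(\phi)=\overline{F(\phi\circ\theta-2Q\ln|z|)},\qquad (F,G)=\langle(\Theta F)\,G\rangle ,$$ and let $\mathcal D$ be the set of all $\mathcal F_{\mathbb D}$-measurable complex functionals $F$ for which $\langle(\Theta F)F\rangle$ converges absolutely. (1) $\mathcal D$ is a complex vector space, $\langle(\Theta F)G\rangle$ converges absolutely for all $F,G\in\mathcal D$, and $(\cdot,\cdot)$ is a positive semidefinite Hermitian form on $\mathcal D$. Let $\mathcal H$ be the Hilbert space completion of $\mathcal D/\{F:(F,F)=0\}$. For $F\in\mathcal D$ the function $$(UF)(c,\varphi)=e^{-Qc}\,\mathbb E_{\mathbb D}F(c+\Phi_{\mathbb D}+P\varphi)$$ is defined by an absolutely convergent expectation for almost every $(c,\varphi)$ and belongs to $L^2(d\mathbb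 P(\varphi)\,dc)$, and $U$ extends to a unitary map of $\mathcal H$ onto $L^2(d\mathbb P(\varphi)\,dc)$. (2) Let $\alpha\in\mathbb C$, $z\in\mathbb D$, let $\rho\ge0$ be a smooth, compactly supported, rotation invariant function with $\int\rho=1$, $\rho_\epsilon=\epsilon^{-2}\rho(\cdot/\epsilon)$, $\phi_\epsilon=\rho_\epsilon*\phi$, and $$V_{\alpha,\epsilon}(z)=e^{\alpha\phi_\epsilon(z)-\frac12\alpha^2\mathbb E\,\Phi_\epsilon(z)^2}.$$ For all small $\epsilon>0$, $V_{\alpha,\epsilon}(z)$ is $\mathcal F_{\mathbb D}$-measurable and the expectation defining $UV_{\alpha,\epsilon}(z)$ converges absolutely for almost every $(c,\varphi)$. As $\epsilon\to0^+$, $$\big(UV_{\alpha,\epsilon}(z)\big)(c,\varphi)\longrightarrow e^{(\alpha-Q)c}:\!e^{\alpha(P\varphi)(z)}\!:$$ for almost every $(c,\varphi)$, and also in $L^2\big([-R,R]\times d\mathbb P(\varphi)\big)$ for every $R>0$. Here $$:\!e^{\alpha(P\varphi)(z)}\!:\;=e^{\alpha(P\varphi)(z)-\frac12\alpha^2\,\mathbb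 E(P\varphi)(z)^2}=(1-|z|^2)^{\frac12\alpha^2}e^{\alpha(P\varphi)(z)} .$$ -/

import Mathlib

open MeasureTheory ProbabilityTheory Filter Topology
open scoped ContDiff ComplexConjugate

noncomputable section

namespace QFree

/-! ### Test densities on the Riemann sphere and field configurations -/

/-- A smooth (real) density on the Riemann sphere: `f(z) d²z` in the chart `z`, and
`f(1 / z̄) |z|⁻⁴ d²z` in the reflected chart `1 / z̄`, both smooth on the whole plane. Equivalently,
`f = h ĝ` with `h` a smooth function on the sphere and `ĝ = 4 (1 + |z|²)⁻²` the round metric.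
These are the functions against which a field `φ` is integrated, `φ f = ∫ φ(z) f(z) d²z`. -/
@[ext]
structure SphereDensity where
  /-- the density in the chart `z` -/
  toFun : ℂ → ℝ
  /-- the density in the chart `1 / z̄` -/
  reflFun : ℂ → ℝ
  smooth_toFun : ContDiff ℝ ∞ toFun
  smooth_reflFun : ContDiff ℝ ∞ reflFun
  reflFun_eq : ∀ z : ℂ, z ≠ 0 → reflFun z = (‖z‖ ^ 4)⁻¹ * toFun (conj z)⁻¹

/-- The image of a density under the reflection `θ z = 1 / z̄`. -/
def SphereDensity.refl (f : SphereDensity) : SphereDensity where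
  toFun := f.reflFun
  reflFun := f.toFun
  smooth_toFun := f.smooth_reflFun
  smooth_reflFun := f.smooth_toFun
  reflFun_eq z hz := by
    have hz' : (conj z)⁻¹ ≠ 0 := by simpa using hz
    have hn : ‖z‖ ≠ 0 := by simpa using hz
    rw [f.reflFun_eq _ hz']
    simp only [map_inv₀, Complex.conj_conj, inv_inv, norm_inv, RCLike.norm_conj]
    field_simp

/-- A smooth compactly supported function on the plane as a density on the sphere. -/
def SphereDensity.ofCompactSupport (u : ℂ → ℝ) (hu : ContDiff ℝ ∞ u) (hc : HasCompactSupport u) :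
    SphereDensity where
  toFun := u
  reflFun z := (‖z‖ ^ 4)⁻¹ * u (conj z)⁻¹
  smooth_toFun := hu
  smooth_reflFun := by
    rw [contDiff_iff_contDiffAt]
    intro z
    by_cases hz : z = 0
    · subst hz
      obtain ⟨R, hR⟩ := hc.isBounded.subset_closedBall (0 : ℂ)
      have hev : (fun z : ℂ => (‖z‖ ^ 4)⁻¹ * u (conj z)⁻¹) =ᶠ[𝓝 0] fun _ => (0 : ℝ) := by
        have hpos : (0 : ℝ) < (max R 1)⁻¹ := by positivity
        filter_upwards [Metric.ball_mem_nhds (0 : ℂ) hpos] with w hw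
        by_cases hw0 : w = 0
        · simp [hw0]
        · have hwn : 0 < ‖w‖ := norm_pos_iff.2 hw0
          have hlt : max R 1 < ‖w‖⁻¹ := by
            rw [lt_inv_comm₀ (by positivity) hwn]
            simpa using hw
          have hns : (conj w)⁻¹ ∉ tsupport u := by
            intro hmem
            have h1 := hR hmem
            simp only [Metric.mem_closedBall, dist_zero_right, norm_inv, RCLike.norm_conj] at h1
            exact absurd (lt_of_le_of_lt (h1.trans (le_max_left R 1)) hlt) (lt_irrefl _)
          rw [image_eq_zero_of_notMem_tsupport hns, mul_zero]
      exact contDiffAt_const.congr_of_eventuallyEq hev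
    · have hz' : conj z ≠ 0 := by simpa using hz
      refine ContDiffAt.mul (ContDiffAt.inv ((contDiffAt_norm ℝ hz).pow 4) ?_) ?_
      · exact pow_ne_zero _ (norm_ne_zero_iff.2 hz)
      · have h1 : ContDiffAt ℝ ∞ (fun w : ℂ => (conj w)⁻¹) z :=
          ContDiffAt.inv (Complex.conjCLE.contDiff.contDiffAt) hz'
        exact hu.contDiffAt.comp z h1
  reflFun_eq _ _ := rfl

/-- Field configurations, described by their pairings `φ f = ∫ φ f` with all test densities.
(Every generalized function is one; a functional that is measurable with respect to the
`σ`-algebra generated by pairings is exactly a measurable function of the pairings.) -/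
abbrev Config : Type := SphereDensity → ℝ

/-- An ordinary function on the plane as a field configuration. -/
def ofFun (u : ℂ → ℝ) : Config := fun f => ∫ z, u z * f.toFun z

/-- The reflected field `(θ φ)(z) = φ(1 / z̄)`. -/
def theta (φ : Config) : Config := fun f => φ f.refl

/-- The `σ`-algebra `𝓕_A` generated by the pairings `∫ φ f` with `supp f ⊆ A`. -/
abbrev fieldSigma (A : Set ℂ) : MeasurableSpace Config :=
  ⨆ (f : SphereDensity) (_ : tsupport f.toFun ⊆ A),
    MeasurableSpace.comap (fun φ : Config => φ f) inferInstance

/-- The open unit disc. -/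
abbrev disc : Set ℂ := Metric.ball (0 : ℂ) 1

/-! ### Gaussian fields -/

/-- A random field whose pairings with test densities form a centred Gaussian process with
covariance `𝔼 [X f * X g] = C f g`. -/
structure IsCentredGaussianField {Ω : Type*} [MeasurableSpace Ω] (μ : Measure Ω)
    (X : Ω → Config) (C : SphereDensity → SphereDensity → ℝ) : Prop where
  measurable_eval : ∀ f, Measurable fun x => X x f
  gaussian : IsGaussianProcess (fun (f : SphereDensity) (x : Ω) => X x f) μ
  mean_zero : ∀ f, ∫ x, X x f ∂μ = 0
  covariance_eq : ∀ f g, ∫ x, X x f * X x g ∂μ = C f g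

/-- `k(z) = log (1 / |z|)` for `|z| ≥ 1`, and `0` otherwise. -/
def kFun (z : ℂ) : ℝ := if 1 ≤ ‖z‖ then Real.log (1 / ‖z‖) else 0

/-- The covariance kernel `log (1 / |z - w|) - k(z) - k(w)` of the free field `Φ` on the sphere
with zero average on the unit circle. -/
def greenSphere (z w : ℂ) : ℝ := Real.log (1 / ‖z - w‖) - kFun z - kFun w

/-- The Dirichlet Green function `log (|1 - z w̄| / |z - w|)` of the disc. -/
def greenDisc (z w : ℂ) : ℝ := Real.log (‖1 - z * conj w‖ / ‖z - w‖)

/-- `Φ` is the Gaussian free field on the sphere with zero average on the unit circle. -/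
def IsFreeField {Ω : Type*} [MeasurableSpace Ω] (μ : Measure Ω) (Φ : Ω → Config) : Prop :=
  IsCentredGaussianField μ Φ fun f g =>
    ∫ z, ∫ w, greenSphere z w * f.toFun z * g.toFun w

/-- `Φ` is the Dirichlet Gaussian free field on the disc (vanishing outside the disc). -/
def IsDirichletField {Ω : Type*} [MeasurableSpace Ω] (μ : Measure Ω) (Φ : Ω → Config) : Prop :=
  IsCentredGaussianField μ Φ fun f g =>
    ∫ z in disc, ∫ w in disc, greenDisc z w * f.toFun z * g.toFun w

/-! ### The free field with background charge and the Osterwalder–Schrader form -/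

/-- The field `φ = c + X + 2 Q k`. -/
def fullField (Q c : ℝ) (X : Config) : Config :=
  ofFun (fun _ => c) + X + ofFun (fun z => 2 * Q * kFun z)

/-- `(Θ F)(φ) = conj (F (θ φ - 2 Q log |z|))`. -/
def Theta (Q : ℝ) (F : Config → ℂ) : Config → ℂ :=
  fun φ => conj (F (theta φ - ofFun fun z => 2 * Q * Real.log ‖z‖))

/-- The linear functional `⟨F⟩ = ∫ dc exp (-2 Q c) 𝔼 F (c + Φ + 2 Q k)`. -/
def freeExp {Ω : Type*} [MeasurableSpace Ω] (Q : ℝ) (μ : Measure Ω) (Φ : Ω → Config)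
    (F : Config → ℂ) : ℂ :=
  ∫ c : ℝ, (Real.exp (-2 * Q * c) : ℂ) * ∫ x, F (fullField Q c (Φ x)) ∂μ

/-- Absolute convergence of `⟨F⟩`. -/
def FreeIntegrable {Ω : Type*} [MeasurableSpace Ω] (Q : ℝ) (μ : Measure Ω) (Φ : Ω → Config)
    (F : Config → ℂ) : Prop :=
  Integrable (fun p : ℝ × Ω => (Real.exp (-2 * Q * p.1) : ℂ) * F (fullField Q p.1 (Φ p.2)))
    ((volume : Measure ℝ).prod μ)

/-- The sesquilinear form `(F, G) = ⟨(Θ F) G⟩`. -/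
def osForm {Ω : Type*} [MeasurableSpace Ω] (Q : ℝ) (μ : Measure Ω) (Φ : Ω → Config)
    (F G : Config → ℂ) : ℂ :=
  freeExp Q μ Φ fun φ => Theta Q F φ * G φ

/-- The domain of the form: all `𝓕_𝔻`-measurable complex functionals `F` for which `(F, F)`
converges absolutely. -/
def osDomain {Ω : Type*} [MeasurableSpace Ω] (Q : ℝ) (μ : Measure Ω) (Φ : Ω → Config) :
    Set (Config → ℂ) :=
  {F | Measurable[fieldSigma disc] F ∧ FreeIntegrable Q μ Φ fun φ => Theta Q F φ * F φ}

/-! ### Completion of a space of functionals with a positive semidefinite form -/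

/-- The vector space `D`, to be given the seminorm of a positive semidefinite sesquilinear form
(and not the topology of pointwise convergence). -/
def PreHilbert {D : Submodule ℂ (Config → ℂ)} (_core : PreInnerProductSpace.Core ℂ D) : Type := D

instance {D : Submodule ℂ (Config → ℂ)} (core : PreInnerProductSpace.Core ℂ D) :
    SeminormedAddCommGroup (PreHilbert core) :=
  @InnerProductSpace.Core.toSeminormedAddCommGroup ℂ D _ _ _ core

instance {D : Submodule ℂ (Config → ℂ)} (core : PreInnerProductSpace.Core ℂ D) :
    InnerProductSpace ℂ (PreHilbert core) :=
  @InnerProductSpace.ofCore ℂ D _ _ _ core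

/-- The Hilbert space of the form: the completion of `D / {F | (F, F) = 0}`. -/
abbrev HilbertCompletion {D : Submodule ℂ (Config → ℂ)} (core : PreInnerProductSpace.Core ℂ D) :
    Type :=
  UniformSpace.Completion (SeparationQuotient (PreHilbert core))

/-- The class in the Hilbert space of a functional. -/
def toHilbert {D : Submodule ℂ (Config → ℂ)} (core : PreInnerProductSpace.Core ℂ D) (F : D) :
    HilbertCompletion core :=
  ((SeparationQuotient.mk (show PreHilbert core from F) :
    SeparationQuotient (PreHilbert core)) : HilbertCompletion core)

/-! ### The field on the circle, its harmonic extension, and the map `U` -/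

/-- The Fourier modes of the field `φ` on the circle: the real coordinates `(α n, β n)`, `n > 0`. -/
abbrev CircleModes : Type := ℕ+ → ℝ × ℝ

/-- `dP(φ) = ∏_{n > 0} (2π)⁻¹ exp (-(αₙ² + βₙ²) / 2) dαₙ dβₙ`. -/
def circleMeasure : Measure CircleModes :=
  Measure.infinitePi fun _ : ℕ+ => (gaussianReal 0 1).prod (gaussianReal 0 1)

/-- `φₙ = (αₙ + i βₙ) / (2 √n)` for `n > 0`; the mode `φ₋ₙ` is its complex conjugate. -/
def mode (a : CircleModes) (n : ℕ+) : ℂ :=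
  ((a n).1 + (a n).2 * Complex.I) / (2 * Real.sqrt (n : ℕ))

/-- `∑_{n > 0} (φₙ z̄ⁿ + φ₋ₙ zⁿ)`, a real number. -/
def harmonicSeries (a : CircleModes) (z : ℂ) : ℝ :=
  (∑' n : ℕ+, (mode a n * conj z ^ (n : ℕ) + conj (mode a n) * z ^ (n : ℕ))).re

/-- The harmonic extension `P φ`: the series in the disc, and `(P φ)(z) = (P φ)(1 / z̄)` outside. -/
def harmonicExt (a : CircleModes) (z : ℂ) : ℝ :=
  if ‖z‖ < 1 then harmonicSeries a z else harmonicSeries a (conj z)⁻¹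

/-- The field `c + Φ_𝔻 + P φ`, where `X` is the value of the Dirichlet field `Φ_𝔻`. -/
def discField (p : ℝ × CircleModes) (X : Config) : Config :=
  ofFun (fun _ => p.1) + X + ofFun (harmonicExt p.2)

/-- The measure `dc dP(φ)`. -/
def targetMeasure : Measure (ℝ × CircleModes) := (volume : Measure ℝ).prod circleMeasure

/-- `(U F)(c, φ) = exp (-Q c) 𝔼_𝔻 F (c + Φ_𝔻 + P φ)`. -/
def UMap {Ω : Type*} [MeasurableSpace Ω] (Q : ℝ) (μ : Measure Ω) (ΦD : Ω → Config)
    (F : Config → ℂ) (p : ℝ × CircleModes) : ℂ :=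
  (Real.exp (-Q * p.1) : ℂ) * ∫ x, F (discField p (ΦD x)) ∂μ

/-! ### Vertex operators -/

/-- A smooth rotation invariant mollifier. -/
structure Mollifier where
  toFun : ℂ → ℝ
  smooth : ContDiff ℝ ∞ toFun
  compact_support : HasCompactSupport toFun
  nonneg : ∀ z, 0 ≤ toFun z
  rotation_invariant : ∀ z w : ℂ, ‖z‖ = ‖w‖ → toFun z = toFun w
  integral_eq_one : ∫ z, toFun z = 1

/-- The density `w ↦ ε⁻² ρ ((z - w) / ε)`; pairing a field with it gives the mollified field
`(ρ_ε * φ)(z)`. -/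
def Mollifier.density (ρ : Mollifier) (ε : ℝ) (z : ℂ) : SphereDensity :=
  SphereDensity.ofCompactSupport (fun w => (ε ^ 2)⁻¹ * ρ.toFun ((ε⁻¹ : ℝ) • (z - w)))
    (by
      have h := ρ.smooth
      fun_prop)
    (by
      by_cases hε : ε = 0
      · have : (fun w : ℂ => (ε ^ 2)⁻¹ * ρ.toFun ((ε⁻¹ : ℝ) • (z - w))) = 0 := by
          funext w
          simp [hε]
        rw [this]
        exact HasCompactSupport.zero
      · have hc : HasCompactSupport fun w : ℂ => ρ.toFun ((ε⁻¹ : ℝ) • (z - w)) :=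
          ρ.compact_support.comp_homeomorph
            ((Homeomorph.subLeft z).trans (Homeomorph.smulOfNeZero (ε⁻¹ : ℝ) (inv_ne_zero hε)))
        exact hc.mul_left)

/-- The regularized vertex operator
`V_{α,ε}(z) = exp (α φ_ε(z) - (α² / 2) 𝔼 Φ_ε(z)²)`, with `φ_ε = ρ_ε * φ`. -/
def vertex {Ω : Type*} [MeasurableSpace Ω] (μ : Measure Ω) (Φ : Ω → Config) (ρ : Mollifier)
    (α : ℂ) (ε : ℝ) (z : ℂ) : Config → ℂ :=
  fun φ => Complex.exp (α * (φ (ρ.density ε z) : ℂ)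
    - α ^ 2 / 2 * ((∫ x, Φ x (ρ.density ε z) ^ 2 ∂μ : ℝ) : ℂ))

/-- The Wick exponential
`:exp (α (P φ)(z)): = exp (α (P φ)(z) - (α² / 2) 𝔼 (P φ)(z)²)`. -/
def wickExp (α : ℂ) (z : ℂ) (a : CircleModes) : ℂ :=
  Complex.exp (α * (harmonicExt a z : ℂ)
    - α ^ 2 / 2 * ((∫ b, harmonicExt b z ^ 2 ∂circleMeasure : ℝ) : ℂ))

end QFree

end

/-!
The reflection `θ` exchanges the disc with its complement, and the free field has the Markov
property across the unit circle: restricted to the disc, the pair formed by `Φ` and `Φ ∘ θ` has the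
law of the pair `(X + P φ, X' + P φ)`, where `X`, `X'` are independent Dirichlet fields and `P φ` is
an independent harmonic extension common to both (`map_sphereHalves_eq`). Both sides are centred
Gaussian processes, so this amounts to three covariance identities: inside the disc
`log (1 / |z - w|)` is the Dirichlet Green function plus `-log |1 - z w̄|`, the covariance of `P φ`
(`sphereCov_inside`), the reflection preserves the covariance (`sphereCov_refl_refl`), and between
the disc and its reflection only `-log |1 - z w̄|` is left (`sphereCov_inside_refl`). Under the
reflection the background charge `2 Q k` becomes `2 Q log |z|`, which `Θ` subtracts, so both
halves are shifted by the constant `c` only.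

Conditionally on `(c, φ)` the two halves are independent and identically distributed, so Fubini's
theorem gives `⟨(Θ F) G⟩ = ∫ conj (U F) * U G` (`osForm_eq`), and absolute convergence means that the
product of the first moments `exp (-Q c) 𝔼_𝔻 |F|` and `exp (-Q c) 𝔼_𝔻 |G|` is integrable
(`freeIntegrable_iff`). Hence the domain consists of the functionals whose weighted first moment is
in `L²`. It is a vector space, the form is the pull-back of the `L²` product under `U`, and `U`
extends to a unitary map as soon as its range is dense (`exists_unitary_of_denseRange`).

For the density, radial bump functions times `Re zⁿ`, `Im zⁿ` give test densities in the disc whose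
pairings with `c + P φ` are exactly the coordinates `c`, `αₙ`, `βₙ` (`coord_eq`). Characters of these
pairings, damped by a Gaussian in the pairing that measures `c`, belong to the domain, and `U` maps
them to non-zero multiples of a fixed positive function of `c` times the character of the
coordinates (`exists_integral_dampedCharacter`). A function orthogonal to all of these vanishes by
the uniqueness of characteristic functions (`denseRange_UMapLp`).

For the vertex operators, a rotation invariant mollifier supported in the disc reproduces harmonic
functions, so that its pairing with `c + P φ` is `c + (P φ)(z)`. The variance of `Φ_ε(z)` is that of
the mollified Dirichlet field plus that of `(P φ)(z)`, and the Gaussian expectation cancels the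
former. For all small `ε` the image of the mollified vertex operator is therefore equal to the
limit (`UMap_vertex`).
-/

noncomputable section

namespace QFree

/-! ### Integrals over the plane -/

/-- Change of variables under the reflection `z ↦ 1 / z̄`, of Jacobian `|z|⁻⁴`. -/
lemma integral_comp_inv_conj (h : ℂ → ℝ) :
    ∫ z : ℂ, (‖z‖ ^ 4)⁻¹ * h (conj z)⁻¹ = ∫ z, h z := by
  have hnull : ∀ u : ℂ → ℝ, ∫ z in ({0}ᶜ : Set ℂ), u z = ∫ z, u z := fun u =>
    setIntegral_eq_integral_of_ae_compl_eq_zero (by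
      filter_upwards [compl_mem_ae_iff.2 (measure_singleton (0 : ℂ))] with z hz hz'
      exact absurd hz hz')
  have hinv : ∫ z in ({0}ᶜ : Set ℂ), h z = ∫ z in ({0}ᶜ : Set ℂ), (‖z‖ ^ 4)⁻¹ * h z⁻¹ := by
    have himg : (fun z : ℂ => z⁻¹) '' ({0}ᶜ : Set ℂ) = {0}ᶜ := by
      ext z
      simp only [Set.mem_image, Set.mem_compl_iff, Set.mem_singleton_iff]
      exact ⟨fun ⟨x, hx, hxz⟩ => hxz ▸ inv_ne_zero hx, fun hz => ⟨z⁻¹, inv_ne_zero hz, inv_inv z⟩⟩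
    have key := integral_image_eq_integral_abs_det_fderiv_smul (volume : Measure ℂ)
      (s := ({0}ᶜ : Set ℂ)) (f := fun z : ℂ => z⁻¹)
      (f' := fun z => (ContinuousLinearMap.toSpanSingleton ℂ (-(z ^ 2)⁻¹)).restrictScalars ℝ)
      (measurableSet_singleton 0).compl
      (fun z hz => ((hasDerivAt_inv hz).hasFDerivAt.restrictScalars ℝ).hasFDerivWithinAt)
      (fun z _ w _ hzw => inv_injective hzw) h
    rw [himg] at key
    rw [key]
    refine setIntegral_congr_fun (measurableSet_singleton 0).compl fun z _ => ?_
    have hdet : ((ContinuousLinearMap.toSpanSingleton ℂ (-(z ^ 2)⁻¹)).restrictScalars ℝ).det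
        = Complex.normSq (-(z ^ 2)⁻¹) := by
      rw [← Algebra.norm_complex_apply, Algebra.norm_apply, ContinuousLinearMap.det]
      congr 1
      ext x
      simp [mul_comm]
    simp only [hdet, smul_eq_mul]
    congr 1
    rw [Complex.normSq_eq_norm_sq, norm_neg, norm_inv, norm_pow, inv_pow, ← pow_mul,
      abs_of_nonneg (by positivity)]
  rw [← hnull h, hinv, hnull, ← Complex.conjLIE.measurePreserving.integral_comp'
    (f := Complex.conjLIE.toHomeomorph.toMeasurableEquiv) fun z : ℂ => (‖z‖ ^ 4)⁻¹ * h z⁻¹]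
  refine integral_congr_ae (ae_of_all _ fun z => ?_)
  show _ = (‖conj z‖ ^ 4)⁻¹ * h (conj z)⁻¹
  rw [RCLike.norm_conj]

/-- Integration against a reflected density is integration of the reflected function. -/
lemma integral_mul_refl (f : SphereDensity) (g : ℂ → ℝ) :
    ∫ z, g z * f.refl.toFun z = ∫ z, g (conj z)⁻¹ * f.toFun z := by
  rw [← integral_comp_inv_conj fun z => g (conj z)⁻¹ * f.toFun z]
  refine integral_congr_ae ?_
  filter_upwards [compl_mem_ae_iff.2 (measure_singleton (0 : ℂ))] with z hz
  have : f.refl.toFun z = (‖z‖ ^ 4)⁻¹ * f.toFun (conj z)⁻¹ := f.reflFun_eq z hz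
  rw [this]
  simp only [map_inv₀, Complex.conj_conj, inv_inv]
  ring

lemma locallyIntegrable_log_norm : LocallyIntegrable (fun z : ℂ => Real.log ‖z‖) := by
  refine (locallyIntegrable_iff).2 fun k hk => ?_
  obtain ⟨r, hr⟩ := hk.isBounded.subset_ball (0 : ℂ)
  refine IntegrableOn.mono_set ?_ hr
  refine integrableOn_ball_of_norm_le_rpow (C := r ^ 2 + 1) (α := 1) (by simp) (by simp)
    ?_ (Real.measurable_log.comp measurable_norm).aestronglyMeasurable
  refine (ae_restrict_iff' Metric.isOpen_ball.measurableSet).2 (ae_of_all _ fun z hz => ?_)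
  by_cases h0 : z = 0
  · simp [h0]
  have hz0 : 0 < ‖z‖ := norm_pos_iff.2 h0
  have hzr : ‖z‖ < r := by simpa using hz
  rw [Real.rpow_neg_one, Real.norm_eq_abs, abs_le]
  have h1 := Real.log_le_self hz0.le
  have h2 := Real.log_le_self (inv_pos.2 hz0).le
  rw [Real.log_inv] at h2
  have h3 : ‖z‖ ≤ r ^ 2 * ‖z‖⁻¹ := by
    rw [← div_eq_mul_inv, le_div_iff₀ hz0]
    nlinarith
  have h4 : 0 < ‖z‖⁻¹ := inv_pos.2 hz0
  constructor <;> nlinarith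

/-! ### Densities supported in the disc -/

/-- The test densities whose support is contained in the open unit disc. -/
abbrev DiscDensity : Type := {f : SphereDensity // tsupport f.toFun ⊆ disc}

lemma DiscDensity.continuous (f : DiscDensity) : Continuous f.1.toFun := f.1.smooth_toFun.continuous

lemma DiscDensity.hasCompactSupport (f : DiscDensity) : HasCompactSupport f.1.toFun :=
  (isCompact_closedBall (0 : ℂ) 1).of_isClosed_subset (isClosed_tsupport _)
    (f.2.trans Metric.ball_subset_closedBall)

lemma DiscDensity.integrable (f : DiscDensity) : Integrable f.1.toFun :=
  f.continuous.integrable_of_hasCompactSupport f.hasCompactSupport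

/-- A density supported in the open disc is supported in a smaller concentric closed disc. -/
lemma DiscDensity.exists_radius (f : DiscDensity) :
    ∃ r : ℝ, 0 < r ∧ r < 1 ∧ ∀ z, f.1.toFun z ≠ 0 → ‖z‖ ≤ r := by
  obtain ⟨r, hr, h⟩ := exists_pos_lt_subset_ball (x := (0 : ℂ)) one_pos (isClosed_tsupport _) f.2
  exact ⟨r, hr.1, hr.2, fun z hz => (mem_ball_zero_iff.1 (h (subset_tsupport _ hz))).le⟩

lemma DiscDensity.norm_lt_one (f : DiscDensity) {z : ℂ} (hz : f.1.toFun z ≠ 0) : ‖z‖ < 1 := by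
  simpa using f.2 (subset_tsupport _ hz)

lemma DiscDensity.setIntegral_disc (f : DiscDensity) (h : ℂ → ℝ) :
    ∫ z in disc, h z * f.1.toFun z = ∫ z, h z * f.1.toFun z := by
  refine setIntegral_eq_integral_of_forall_compl_eq_zero fun z hz => ?_
  by_contra hne
  exact hz (by simpa using f.norm_lt_one (right_ne_zero_of_mul hne))

/-- The total mass `∫ f` of a density. -/
def mass (f : SphereDensity) : ℝ := ∫ z, f.toFun z

/-- The harmonic moment `∫ zⁿ f(z) d²z`. -/
def moment (f : SphereDensity) (n : ℕ+) : ℂ := ∫ z, z ^ (n : ℕ) * (f.toFun z : ℂ)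

lemma mass_refl (f : SphereDensity) : mass f.refl = mass f := by
  simpa [mass] using integral_mul_refl f fun _ => 1

/-- Pairing a harmonic series `∑ Re (bₙ z̄ⁿ)`, convergent in the disc, with a density supported in
the disc only sees the moments of the density. -/
lemma hasSum_integral_modes {b : ℕ+ → ℂ}
    (hb : ∀ r : ℝ, 0 < r → r < 1 → Summable fun n => ‖b n‖ * r ^ (n : ℕ)) (f : DiscDensity) :
    HasSum (fun n => (b n * conj (moment f.1 n)).re)
      (∫ z, (∑' n, (b n * conj z ^ (n : ℕ)).re) * f.1.toFun z) := by
  obtain ⟨r, hr0, hr1, hr⟩ := f.exists_radius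
  have hcont : ∀ n : ℕ+, Continuous fun z : ℂ => z ^ (n : ℕ) * (f.1.toFun z : ℂ) := fun n => by
    have := f.continuous
    fun_prop
  have hint : ∀ n : ℕ+, Integrable fun z : ℂ => z ^ (n : ℕ) * (f.1.toFun z : ℂ) := fun n =>
    (hcont n).integrable_of_hasCompactSupport
      ((f.hasCompactSupport.comp_left (g := fun x : ℝ => (x : ℂ)) (by simp)).mul_left)
  have hterm : ∀ n : ℕ+, ∀ z : ℂ, (b n * conj z ^ (n : ℕ)).re * f.1.toFun z
      = (b n * conj (z ^ (n : ℕ) * (f.1.toFun z : ℂ))).re := fun n z => by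
    rw [map_mul, map_pow, Complex.conj_ofReal, ← mul_assoc, Complex.re_mul_ofReal]
  have hintc : ∀ n : ℕ+, Integrable fun z : ℂ =>
      b n * conj (z ^ (n : ℕ) * (f.1.toFun z : ℂ)) := fun n =>
    (Complex.conjCLE.integrable_comp_iff.2 (hint n)).const_mul (b n)
  have hI : ∀ n : ℕ+, Integrable fun z : ℂ => (b n * conj z ^ (n : ℕ)).re * f.1.toFun z :=
    fun n => by
      simp_rw [hterm]
      exact (hintc n).re
  have hbound : ∀ n : ℕ+, ∀ z : ℂ, ‖(b n * conj z ^ (n : ℕ)).re * f.1.toFun z‖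
      ≤ ‖b n‖ * r ^ (n : ℕ) * ‖f.1.toFun z‖ := fun n z => by
    by_cases hz : f.1.toFun z = 0
    · simp [hz]
    · rw [norm_mul]
      gcongr
      calc ‖(b n * conj z ^ (n : ℕ)).re‖ ≤ ‖b n * conj z ^ (n : ℕ)‖ := Complex.abs_re_le_norm _
        _ = ‖b n‖ * ‖z‖ ^ (n : ℕ) := by simp
        _ ≤ ‖b n‖ * r ^ (n : ℕ) := by
          gcongr
          exact hr z hz
  have hsum := hasSum_integral_of_summable_integral_norm hI
    (Summable.of_nonneg_of_le (fun n => integral_nonneg fun z => norm_nonneg _)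
      (fun n => by
        calc ∫ z, ‖(b n * conj z ^ (n : ℕ)).re * f.1.toFun z‖
            ≤ ∫ z, ‖b n‖ * r ^ (n : ℕ) * ‖f.1.toFun z‖ :=
              integral_mono (hI n).norm (f.integrable.norm.const_mul _) (hbound n)
          _ = ‖b n‖ * r ^ (n : ℕ) * ∫ z, ‖f.1.toFun z‖ := integral_const_mul _ _)
      ((hb r hr0 hr1).mul_right _))
  simp_rw [tsum_mul_right] at hsum
  refine hsum.congr_fun ?_
  · intro n
    simp_rw [hterm]
    have h1 : ∫ z, (b n * conj (z ^ (n : ℕ) * (f.1.toFun z : ℂ))).re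
        = (∫ z, b n * conj (z ^ (n : ℕ) * (f.1.toFun z : ℂ))).re := integral_re (hintc n)
    rw [h1, integral_const_mul, integral_conj]
    rfl

lemma integrable_modes {b : ℕ+ → ℂ}
    (hb : ∀ r : ℝ, 0 < r → r < 1 → Summable fun n => ‖b n‖ * r ^ (n : ℕ)) (f : DiscDensity) :
    Integrable fun z => (∑' n, (b n * conj z ^ (n : ℕ)).re) * f.1.toFun z := by
  obtain ⟨r, hr0, hr1, hr⟩ := f.exists_radius
  refine (f.integrable.norm.const_mul (∑' n, ‖b n‖ * r ^ (n : ℕ))).mono' ?_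
    (ae_of_all _ fun z => ?_)
  · refine (Measurable.mul (Measurable.tsum fun n => ?_)
      f.continuous.measurable).aestronglyMeasurable
    fun_prop
  · by_cases hz : f.1.toFun z = 0
    · simp [hz]
    · rw [norm_mul]
      gcongr
      refine tsum_of_norm_bounded (hb r hr0 hr1).hasSum fun n => ?_
      calc ‖(b n * conj z ^ (n : ℕ)).re‖ ≤ ‖b n * conj z ^ (n : ℕ)‖ := Complex.abs_re_le_norm _
        _ = ‖b n‖ * ‖z‖ ^ (n : ℕ) := by simp
        _ ≤ ‖b n‖ * r ^ (n : ℕ) := by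
          gcongr
          exact hr z hz

lemma norm_moment_le (f : DiscDensity) :
    ∃ r C : ℝ, 0 < r ∧ r < 1 ∧ 0 ≤ C ∧ ∀ n, ‖moment f.1 n‖ ≤ C * r ^ (n : ℕ) := by
  obtain ⟨r, hr0, hr1, hr⟩ := f.exists_radius
  refine ⟨r, ∫ z, ‖f.1.toFun z‖, hr0, hr1, integral_nonneg fun _ => norm_nonneg _, fun n => ?_⟩
  rw [← integral_mul_const]
  refine norm_integral_le_of_norm_le (f.integrable.norm.mul_const _) (ae_of_all _ fun z => ?_)
  by_cases hz : f.1.toFun z = 0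
  · simp [hz]
  · rw [norm_mul, norm_pow, Complex.norm_real, mul_comm]
    gcongr
    exact hr z hz

/-! ### The covariance of the two halves of the free field -/

/-- The covariance `∑ₙ Re (mₙ(f) m̄ₙ(g)) / n` of the harmonic field, in terms of moments. -/
def modeCov (m m' : ℕ+ → ℂ) : ℝ := ∑' n : ℕ+, (m n * conj (m' n)).re / (n : ℕ)

lemma hasSum_neg_log_norm {z w : ℂ} (hz : ‖z‖ < 1) (hw : ‖w‖ < 1) :
    HasSum (fun n : ℕ+ => (z ^ (n : ℕ) / (n : ℕ) * conj w ^ (n : ℕ)).re)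
      (-Real.log ‖1 - z * conj w‖) := by
  have hlt : ‖z * conj w‖ < 1 := by
    rw [norm_mul, RCLike.norm_conj]
    exact mul_lt_one_of_nonneg_of_lt_one_left (norm_nonneg _) hz hw.le
  have h := Complex.hasSum_re (Complex.hasSum_taylorSeries_neg_log hlt)
  rw [Complex.neg_re, Complex.log_re] at h
  have h0 : ((z * conj w) ^ 0 / ((0 : ℕ) : ℂ)).re = 0 := by simp
  have h' := (hasSum_nat_add_iff' 1).2 h
  simp only [Finset.range_one, Finset.sum_singleton, h0, sub_zero] at h'
  rw [← Equiv.pnatEquivNat.symm.hasSum_iff]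
  refine h'.congr_fun fun n => ?_
  simp only [Function.comp, Equiv.pnatEquivNat_symm_apply, Nat.succPNat_coe, Nat.succ_eq_add_one]
  rw [mul_pow, div_mul_eq_mul_div]

lemma summable_mul_pow_div {z : ℂ} (hz : ‖z‖ < 1) (r : ℝ) (hr0 : 0 < r) (hr1 : r < 1) :
    Summable fun n : ℕ+ => ‖z ^ (n : ℕ) / (n : ℕ)‖ * r ^ (n : ℕ) := by
  refine Summable.of_nonneg_of_le (fun n => by positivity) (fun n => ?_)
    ((summable_geometric_of_lt_one hr0.le hr1).comp_injective PNat.coe_injective)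
  have h1 : ‖z ^ (n : ℕ) / (n : ℕ)‖ ≤ 1 := by
    rw [norm_div, norm_pow, Complex.norm_natCast]
    exact div_le_one_of_le₀ ((pow_le_one₀ (norm_nonneg _) hz.le).trans
      (by exact_mod_cast n.pos)) (by positivity)
  exact mul_le_of_le_one_left (by positivity) h1

lemma integral_neg_log_right {z : ℂ} (hz : ‖z‖ < 1) (g : DiscDensity) :
    HasSum (fun n : ℕ+ => (z ^ (n : ℕ) / (n : ℕ) * conj (moment g.1 n)).re)
      (∫ w, -Real.log ‖1 - z * conj w‖ * g.1.toFun w) := by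
  convert hasSum_integral_modes (summable_mul_pow_div hz) g using 2
  funext w
  by_cases hw : g.1.toFun w = 0
  · simp [hw]
  · rw [(hasSum_neg_log_norm hz (g.norm_lt_one hw)).tsum_eq]

lemma summable_moment_div_mul (g : DiscDensity) (r : ℝ) (hr0 : 0 < r) (hr1 : r < 1) :
    Summable fun n : ℕ+ => ‖moment g.1 n / (n : ℕ)‖ * r ^ (n : ℕ) := by
  obtain ⟨s, C, hs0, hs1, hC, hs⟩ := norm_moment_le g
  refine Summable.of_nonneg_of_le (fun n => by positivity) (fun n => ?_)
    (((summable_geometric_of_lt_one hr0.le hr1).comp_injective PNat.coe_injective).mul_left C)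
  have h1 : ‖moment g.1 n / (n : ℕ)‖ ≤ C := by
    rw [norm_div, Complex.norm_natCast]
    refine (div_le_self (norm_nonneg _) (by exact_mod_cast n.pos)).trans ((hs n).trans ?_)
    exact mul_le_of_le_one_right hC (pow_le_one₀ hs0.le hs1.le)
  exact mul_le_mul_of_nonneg_right h1 (by positivity)

lemma re_div_mul_conj (n : ℕ+) (a c : ℂ) :
    (a / (n : ℕ) * conj c).re = (c / (n : ℕ) * conj a).re := by
  rw [← Complex.conj_re]
  simp [div_mul_eq_mul_div, mul_comm]

lemma neg_log_potential_mul (f g : DiscDensity) (z : ℂ) :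
    (∫ w, -Real.log ‖1 - z * conj w‖ * g.1.toFun w) * f.1.toFun z
      = (∑' n : ℕ+, (moment g.1 n / (n : ℕ) * conj z ^ (n : ℕ)).re) * f.1.toFun z := by
  by_cases hz : f.1.toFun z = 0
  · simp [hz]
  · rw [← (integral_neg_log_right (f.norm_lt_one hz) g).tsum_eq]
    congr 1
    refine tsum_congr fun n => ?_
    rw [re_div_mul_conj, map_pow]

/-- The kernel `-log |1 - z w̄|`, paired with two densities in the disc. -/
lemma integral_integral_neg_log (f g : DiscDensity) :
    ∫ z, (∫ w, -Real.log ‖1 - z * conj w‖ * g.1.toFun w) * f.1.toFun z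
      = modeCov (moment f.1) (moment g.1) := by
  have h := hasSum_integral_modes (summable_moment_div_mul g) f
  simp_rw [neg_log_potential_mul]
  rw [modeCov, ← h.tsum_eq]
  refine tsum_congr fun n => ?_
  rw [re_div_mul_conj, div_mul_eq_mul_div, ← Complex.ofReal_natCast, Complex.div_ofReal_re]

lemma continuous_potential (g : DiscDensity) :
    Continuous fun z => ∫ w, Real.log ‖z - w‖ * g.1.toFun w := by
  have h := g.hasCompactSupport.continuous_convolution_left (ContinuousLinearMap.mul ℝ ℝ)
    g.continuous locallyIntegrable_log_norm
  convert h using 2 with z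
  simp [convolution, mul_comm]

lemma integrable_log_mul (g : DiscDensity) (z : ℂ) :
    Integrable fun w => Real.log ‖z - w‖ * g.1.toFun w := by
  have h := g.hasCompactSupport.convolutionExists_left (ContinuousLinearMap.mul ℝ ℝ)
    g.continuous locallyIntegrable_log_norm z
  simpa [ConvolutionExistsAt, mul_comm] using h

lemma kFun_of_norm_lt_one {z : ℂ} (hz : ‖z‖ < 1) : kFun z = 0 := if_neg (not_le.2 hz)

lemma kFun_inv_conj {z : ℂ} (hz0 : z ≠ 0) (hz : ‖z‖ < 1) : kFun (conj z)⁻¹ = Real.log ‖z‖ := by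
  have h0 : 0 < ‖z‖ := norm_pos_iff.2 hz0
  rw [kFun, if_pos]
  · simp
  · simpa using (one_le_inv₀ h0).2 hz.le

lemma ae_ne (z : ℂ) : ∀ᵐ w : ℂ, w ≠ z := compl_mem_ae_iff.2 (measure_singleton z)

/-- Pulling the density in the outer variable out of a double integral. -/
lemma double_integral_eq (K : ℂ → ℂ → ℝ) (f g : ℂ → ℝ) :
    ∫ z, ∫ w, K z w * f z * g w = ∫ z, (∫ w, K z w * g w) * f z := by
  refine integral_congr_ae (ae_of_all _ fun z => ?_)
  simp only
  rw [← integral_mul_const]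
  exact integral_congr_ae (ae_of_all _ fun w => by simp only; ring)

lemma integral_congr_disc {f : DiscDensity} {u v : ℂ → ℝ} {s : Set ℂ} (hs : ∀ᵐ z, z ∉ s)
    (h : ∀ z, z ∉ s → ‖z‖ < 1 → u z = v z) :
    ∫ z, u z * f.1.toFun z = ∫ z, v z * f.1.toFun z := by
  refine integral_congr_ae ?_
  filter_upwards [hs] with z hz
  by_cases hf : f.1.toFun z = 0
  · simp [hf]
  · rw [h z hz (f.norm_lt_one hf)]

lemma sphereCov_inside_eq (f g : DiscDensity) :
    ∫ z, ∫ w, greenSphere z w * f.1.toFun z * g.1.toFun w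
      = ∫ z, (∫ w, -Real.log ‖z - w‖ * g.1.toFun w) * f.1.toFun z := by
  rw [double_integral_eq]
  refine integral_congr_disc (s := ∅) (by simp) fun z _ hz => ?_
  refine integral_congr_disc (s := ∅) (by simp) fun w _ hw => ?_
  rw [greenSphere, kFun_of_norm_lt_one hz, kFun_of_norm_lt_one hw, one_div, Real.log_inv]
  ring

/-- Inside the disc the free field covariance splits into the Dirichlet covariance and the
covariance of the harmonic extension. -/
lemma sphereCov_inside (f g : DiscDensity) :
    ∫ z, ∫ w, greenSphere z w * f.1.toFun z * g.1.toFun w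
      = (∫ z in disc, ∫ w in disc, greenDisc z w * f.1.toFun z * g.1.toFun w)
        + modeCov (moment f.1) (moment g.1) := by
  have hD : ∫ z in disc, ∫ w in disc, greenDisc z w * f.1.toFun z * g.1.toFun w
      = ∫ z, ((∫ w, -Real.log ‖z - w‖ * g.1.toFun w)
          - ∫ w, -Real.log ‖1 - z * conj w‖ * g.1.toFun w) * f.1.toFun z := by
    have h1 : ∫ z in disc, ∫ w in disc, greenDisc z w * f.1.toFun z * g.1.toFun w
        = ∫ z in disc, (∫ w, greenDisc z w * g.1.toFun w) * f.1.toFun z := by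
      congr 1
      funext z
      rw [g.setIntegral_disc fun w => greenDisc z w * f.1.toFun z, ← integral_mul_const]
      congr 1
      funext w
      ring
    rw [h1, f.setIntegral_disc]
    refine integral_congr_disc (s := ∅) (by simp) fun z _ hz => ?_
    have hi1 : Integrable fun w => -Real.log ‖z - w‖ * g.1.toFun w := by
      simpa [neg_mul] using (integrable_log_mul g z).neg
    have hlt : ∀ w : ℂ, ‖w‖ < 1 → (1 - z * conj w) ≠ 0 := fun w hw h0 => by
      have : ‖z * conj w‖ < 1 := by
        rw [norm_mul, RCLike.norm_conj]
        exact mul_lt_one_of_nonneg_of_lt_one_left (norm_nonneg _) hz hw.le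
      rw [← sub_eq_zero.1 h0] at this
      simp at this
    have hi2 : Integrable fun w => -Real.log ‖1 - z * conj w‖ * g.1.toFun w := by
      refine Continuous.integrable_of_hasCompactSupport ?_ g.hasCompactSupport.mul_left
      refine continuous_iff_continuousAt.2 fun w => ?_
      by_cases hw : w ∈ tsupport g.1.toFun
      · have hw1 : ‖w‖ < 1 := by simpa using g.2 hw
        refine ContinuousAt.mul (ContinuousAt.neg (ContinuousAt.log ?_ ?_))
          g.continuous.continuousAt
        · exact (continuous_const.sub (continuous_const.mul Complex.continuous_conj)).norm.continuousAt
        · exact norm_ne_zero_iff.2 (hlt w hw1)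
      · have h0 : (fun w => -Real.log ‖1 - z * conj w‖ * g.1.toFun w) =ᶠ[𝓝 w] fun _ => 0 := by
          filter_upwards [(isClosed_tsupport g.1.toFun).isOpen_compl.mem_nhds hw] with v hv
          rw [image_eq_zero_of_notMem_tsupport hv, mul_zero]
        exact continuousAt_const.congr h0.symm
    rw [← integral_sub hi1 hi2]
    simp_rw [← sub_mul]
    refine integral_congr_disc (s := {z}) (ae_ne z) fun w hwz hw => ?_
    rw [greenDisc, Real.log_div (norm_ne_zero_iff.2 (hlt w hw))
      (norm_ne_zero_iff.2 (sub_ne_zero.2 (Ne.symm hwz)))]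
    ring
  have hA : Integrable fun z => (∫ w, -Real.log ‖z - w‖ * g.1.toFun w) * f.1.toFun z := by
    have hc : Continuous fun z => ∫ w, -Real.log ‖z - w‖ * g.1.toFun w := by
      simp_rw [neg_mul, integral_neg]
      exact (continuous_potential g).neg
    exact Continuous.integrable_of_hasCompactSupport (hc.mul f.continuous)
      f.hasCompactSupport.mul_left
  have hB : Integrable fun z =>
      (∫ w, -Real.log ‖1 - z * conj w‖ * g.1.toFun w) * f.1.toFun z := by
    simp_rw [neg_log_potential_mul]
    exact integrable_modes (summable_moment_div_mul g) f
  rw [sphereCov_inside_eq, hD, ← integral_integral_neg_log]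
  simp_rw [sub_mul]
  rw [integral_sub hA hB, sub_add_cancel]

/-- The covariance of the free field is invariant under the reflection. -/
lemma sphereCov_refl_refl (f g : DiscDensity) :
    ∫ z, ∫ w, greenSphere z w * f.1.refl.toFun z * g.1.refl.toFun w
      = ∫ z, ∫ w, greenSphere z w * f.1.toFun z * g.1.toFun w := by
  rw [sphereCov_inside_eq, double_integral_eq,
    integral_mul_refl f.1 fun z => ∫ w, greenSphere z w * g.1.refl.toFun w]
  refine integral_congr_disc (s := {0}) (ae_ne 0) fun z hz0 hz => ?_
  rw [integral_mul_refl g.1]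
  refine integral_congr_disc (s := {0} ∪ {z}) ?_ fun w hw0 hw => ?_
  · filter_upwards [ae_ne 0, ae_ne z] with w h1 h2 using by simp [h1, h2]
  have hz0' : z ≠ 0 := hz0
  simp only [Set.mem_union, Set.mem_singleton_iff, not_or] at hw0
  have e : ‖(conj z)⁻¹ - (conj w)⁻¹‖ = ‖z - w‖ / (‖z‖ * ‖w‖) := by
    rw [← map_inv₀, ← map_inv₀, ← map_sub, RCLike.norm_conj, inv_sub_inv hz0' hw0.1, norm_div,
      norm_mul, norm_sub_rev]
  have hz1 : ‖z‖ ≠ 0 := norm_ne_zero_iff.2 hz0'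
  have hw1 : ‖w‖ ≠ 0 := norm_ne_zero_iff.2 hw0.1
  have hzw : ‖z - w‖ ≠ 0 := norm_ne_zero_iff.2 (sub_ne_zero.2 (Ne.symm hw0.2))
  rw [greenSphere, kFun_inv_conj hz0' hz, kFun_inv_conj hw0.1 hw, e, one_div, Real.log_inv,
    Real.log_div hzw (mul_ne_zero hz1 hw1), Real.log_mul hz1 hw1]
  ring

/-- The covariance of the free field between the disc and its reflection is that of the harmonic
extension. -/
lemma sphereCov_inside_refl (f g : DiscDensity) :
    ∫ z, ∫ w, greenSphere z w * f.1.toFun z * g.1.refl.toFun w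
      = modeCov (moment f.1) (moment g.1) := by
  rw [double_integral_eq, ← integral_integral_neg_log]
  refine integral_congr_disc (s := ∅) (by simp) fun z _ hz => ?_
  rw [integral_mul_refl g.1]
  refine integral_congr_disc (s := {0}) (ae_ne 0) fun w hw0 hw => ?_
  have hw0' : w ≠ 0 := hw0
  have hw1 : ‖w‖ ≠ 0 := norm_ne_zero_iff.2 hw0'
  have hc : conj w ≠ 0 := by simpa using hw0'
  have hne : ‖1 - z * conj w‖ ≠ 0 := by
    refine norm_ne_zero_iff.2 fun h0 => ?_
    have : ‖z * conj w‖ < 1 := by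
      rw [norm_mul, RCLike.norm_conj]
      exact mul_lt_one_of_nonneg_of_lt_one_left (norm_nonneg _) hz hw.le
    rw [← sub_eq_zero.1 h0] at this
    simp at this
  have e : ‖z - (conj w)⁻¹‖ = ‖1 - z * conj w‖ / ‖w‖ := by
    rw [← RCLike.norm_conj w, ← norm_div, norm_sub_rev]
    congr 1
    field_simp
  rw [greenSphere, kFun_of_norm_lt_one hz, kFun_inv_conj hw0' hw, e, one_div, Real.log_inv,
    Real.log_div hne hw1]
  ring

/-! ### Gaussian laws and characteristic functions of processes -/

/-- A finite measure on a product of lines is determined by its characteristic function. -/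
lemma measure_ext_of_charFun {T : Type*} {ν₁ ν₂ : Measure (T → ℝ)} [IsFiniteMeasure ν₁]
    [IsFiniteMeasure ν₂]
    (h : ∀ (I : Finset T) (s : T → ℝ),
      ∫ x, Complex.exp (Complex.I * ((∑ t ∈ I, s t * x t : ℝ) : ℂ)) ∂ν₁
        = ∫ x, Complex.exp (Complex.I * ((∑ t ∈ I, s t * x t : ℝ) : ℂ)) ∂ν₂) :
    ν₁ = ν₂ := by
  classical
  have h1 : IsProjectiveLimit ν₁ fun I : Finset T => ν₁.map I.restrict := fun I => rfl
  have h2 : IsProjectiveLimit ν₂ fun I : Finset T => ν₁.map I.restrict := fun I => by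
    symm
    refine Measure.ext_of_charFunDual ?_
    ext L
    let s : T → ℝ := fun t => if ht : t ∈ I then L (Pi.single ⟨t, ht⟩ 1) else 0
    have hL : ∀ x : T → ℝ, L (I.restrict x) = ∑ t ∈ I, s t * x t := fun x => by
      have hx : (I.restrict x : I → ℝ) = ∑ t : I, x t • Pi.single t (1 : ℝ) := by
        ext t
        simp [Finset.sum_apply, Pi.single_apply]
      rw [hx, map_sum, ← Finset.sum_coe_sort I]
      refine Finset.sum_congr rfl fun t _ => ?_
      simp [s, mul_comm]
    have hmeas : Measurable (I.restrict : (T → ℝ) → (I → ℝ)) := Finset.measurable_restrict I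
    have hcont : ∀ ν : Measure (I → ℝ), AEStronglyMeasurable
        (fun y : I → ℝ => Complex.exp (L y * Complex.I)) ν := fun ν => by
      have : Continuous fun y : I → ℝ => Complex.exp (L y * Complex.I) := by fun_prop
      exact this.aestronglyMeasurable
    rw [charFunDual_apply, charFunDual_apply, integral_map hmeas.aemeasurable (hcont _),
      integral_map hmeas.aemeasurable (hcont _)]
    simp_rw [hL, mul_comm _ Complex.I]
    exact h I s
  exact h1.unique h2

section GaussianReal

variable {Ω : Type*} [MeasurableSpace Ω] {μ : Measure Ω}

lemma integrable_cexp_mul {Y : Ω → ℝ} {v : NNReal} (hY : AEMeasurable Y μ)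
    (h : μ.map Y = gaussianReal 0 v) (z : ℂ) :
    Integrable (fun x => Complex.exp (z * (Y x : ℂ))) μ := by
  have h1 : Integrable (fun y : ℝ => Complex.exp (z * (y : ℂ))) (μ.map Y) := by
    rw [h, ← integrable_norm_iff (by fun_prop)]
    simp_rw [Complex.norm_exp, Complex.mul_re, Complex.ofReal_re, Complex.ofReal_im, mul_zero,
      sub_zero]
    exact integrable_exp_mul_gaussianReal z.re
  exact h1.comp_aemeasurable hY

lemma integral_cexp_mul {Y : Ω → ℝ} {v : NNReal} (h : μ.map Y = gaussianReal 0 v) (z : ℂ) :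
    ∫ x, Complex.exp (z * (Y x : ℂ)) ∂μ = Complex.exp (z ^ 2 / 2 * (v : ℝ)) := by
  have := complexMGF_gaussianReal h z
  rw [complexMGF] at this
  rw [this]
  congr 1
  push_cast
  ring

variable {X : Ω → Config} {C : SphereDensity → SphereDensity → ℝ}

/-- The covariance `∑ᵢⱼ sᵢ sⱼ C(fᵢ, fⱼ)` of a finite linear combination. -/
def quadForm {ι : Type*} (C : ι → ι → ℝ) (I : Finset ι) (s : ι → ℝ) : ℝ :=
  ∑ i ∈ I, ∑ j ∈ I, s i * s j * C i j

lemma IsCentredGaussianField.map_sum (hX : IsCentredGaussianField μ X C) {ι : Type*}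
    (f : ι → SphereDensity) (I : Finset ι) (s : ι → ℝ) :
    0 ≤ quadForm (fun i j => C (f i) (f j)) I s ∧
    μ.map (fun x => ∑ i ∈ I, s i * X x (f i))
      = gaussianReal 0 (quadForm (fun i j => C (f i) (f j)) I s).toNNReal := by
  have hproc : IsGaussianProcess (fun (i : ι) (x : Ω) => s i • X x (f i)) μ := by
    have := (hX.gaussian.comp_right f).smul s
    exact this
  have hlaw := hproc.hasGaussianLaw_fun_sum (I := I)
  have := hlaw.isProbabilityMeasure
  have h2 : ∀ i, MemLp (fun x => X x (f i)) 2 μ := fun i =>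
    (hX.gaussian.hasGaussianLaw_eval (f i)).memLp_two
  have hmean : ∫ x, ∑ i ∈ I, s i • X x (f i) ∂μ = 0 := by
    simp_rw [smul_eq_mul]
    rw [integral_finsetSum _ fun i _ => ((h2 i).integrable one_le_two).const_mul _]
    refine Finset.sum_eq_zero fun i _ => ?_
    rw [integral_const_mul, hX.mean_zero, mul_zero]
  have hsq : ∫ x, (∑ i ∈ I, s i • X x (f i)) ^ 2 ∂μ
      = quadForm (fun i j => C (f i) (f j)) I s := by
    have hij : ∀ i j, Integrable (fun x => s i * s j * (X x (f i) * X x (f j))) μ := fun i j =>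
      ((h2 i).integrable_mul (h2 j)).const_mul _
    have hexp : ∀ x, (∑ i ∈ I, s i • X x (f i)) ^ 2
        = ∑ i ∈ I, ∑ j ∈ I, s i * s j * (X x (f i) * X x (f j)) := fun x => by
      rw [sq, Finset.sum_mul_sum]
      refine Finset.sum_congr rfl fun i _ => Finset.sum_congr rfl fun j _ => ?_
      simp only [smul_eq_mul]
      ring
    simp_rw [hexp]
    rw [integral_finsetSum _ fun i _ => integrable_finsetSum _ fun j _ => hij i j]
    refine Finset.sum_congr rfl fun i _ => ?_
    rw [integral_finsetSum _ fun j _ => hij i j]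
    refine Finset.sum_congr rfl fun j _ => ?_
    rw [integral_const_mul, hX.covariance_eq]
  refine ⟨hsq ▸ integral_nonneg fun x => sq_nonneg _, ?_⟩
  have key := hlaw.map_eq_gaussianReal
  rw [variance_of_integral_eq_zero hlaw.aemeasurable hmean, hmean, hsq] at key
  exact key

lemma IsCentredGaussianField.integral_cexp_sum (hX : IsCentredGaussianField μ X C) {ι : Type*}
    (f : ι → SphereDensity) (I : Finset ι) (s : ι → ℝ) :
    ∫ x, Complex.exp (Complex.I * ((∑ i ∈ I, s i * X x (f i) : ℝ) : ℂ)) ∂μ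
      = Complex.exp (-(quadForm (fun i j => C (f i) (f j)) I s : ℂ) / 2) := by
  obtain ⟨h0, h⟩ := hX.map_sum f I s
  rw [integral_cexp_mul h, Real.coe_toNNReal _ h0, Complex.I_sq]
  congr 1
  ring

end GaussianReal

/-! ### The Gaussian field on the circle -/

instance : IsProbabilityMeasure circleMeasure := by
  unfold circleMeasure
  infer_instance

/-- The `n`-th term of the pairing of the harmonic extension with a sequence of moments. -/
def modePair (a : CircleModes) (m : ℕ+ → ℂ) (n : ℕ+) : ℝ := (2 * mode a n * conj (m n)).re

/-- The pairing of the harmonic extension with a sequence of moments. -/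
def modeSum (a : CircleModes) (m : ℕ+ → ℂ) : ℝ := ∑' n, modePair a m n

lemma modePair_eq (a : CircleModes) (m : ℕ+ → ℂ) (n : ℕ+) :
    modePair a m n = ((a n).1 * (m n).re + (a n).2 * (m n).im) / Real.sqrt (n : ℕ) := by
  have : 2 * mode a n * conj (m n)
      = (((a n).1 + (a n).2 * Complex.I) * conj (m n)) / ((Real.sqrt (n : ℕ) : ℝ) : ℂ) := by
    rw [mode, ← mul_div_assoc, mul_div_mul_left _ _ two_ne_zero, div_mul_eq_mul_div]
  rw [modePair, this, Complex.div_ofReal_re]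
  simp

lemma measurable_modePair (m : ℕ+ → ℂ) (n : ℕ+) : Measurable fun a => modePair a m n := by
  simp_rw [modePair_eq]
  fun_prop

@[fun_prop]
lemma measurable_modeSum (m : ℕ+ → ℂ) : Measurable fun a => modeSum a m :=
  Measurable.tsum fun n => measurable_modePair m n

/-- Sequences bounded by a geometric sequence of ratio less than one. -/
def GeometricDecay (m : ℕ+ → ℂ) : Prop :=
  ∃ r C : ℝ, 0 < r ∧ r < 1 ∧ 0 ≤ C ∧ ∀ n, ‖m n‖ ≤ C * r ^ (n : ℕ)

lemma geometricDecay_moment (f : DiscDensity) : GeometricDecay (moment f.1) := norm_moment_le f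

lemma geometricDecay_pow {z : ℂ} (hz : ‖z‖ < 1) : GeometricDecay fun n => z ^ (n : ℕ) := by
  refine ⟨max ‖z‖ (1 / 2), 1, by positivity, max_lt hz (by norm_num), zero_le_one, fun n => ?_⟩
  rw [norm_pow, one_mul]
  gcongr
  exact le_max_left _ _

/-- Modes for which the harmonic series converges absolutely in the whole disc. -/
def ModesSummable (a : CircleModes) : Prop :=
  ∀ r : ℝ, 0 < r → r < 1 → Summable fun n : ℕ+ => ‖mode a n‖ * r ^ (n : ℕ)

lemma norm_mode_le (a : CircleModes) (n : ℕ+) : ‖mode a n‖ ≤ ‖(a n).1‖ + ‖(a n).2‖ := by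
  have h1 : (1 : ℝ) ≤ Real.sqrt (n : ℕ) := by
    rw [Real.one_le_sqrt]
    exact_mod_cast n.pos
  rw [mode, norm_div]
  have h2 : (1 : ℝ) ≤ ‖(2 * Real.sqrt (n : ℕ) : ℂ)‖ := by
    rw [norm_mul, Complex.norm_real, Real.norm_of_nonneg (by positivity), Complex.norm_ofNat]
    linarith
  refine (div_le_self (norm_nonneg _) h2).trans ((norm_add_le _ _).trans ?_)
  simp

/-- Almost every mode sequence has a harmonic extension: the modes have bounded first moments, so
their power series converges in every smaller disc. -/
lemma ae_modesSummable : ∀ᵐ a ∂circleMeasure, ModesSummable a := by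
  have hK : ∫⁻ p : ℝ × ℝ, (‖p.1‖ₑ + ‖p.2‖ₑ) ∂(gaussianReal 0 1).prod (gaussianReal 0 1) ≠ ⊤ := by
    have hid : Integrable (fun x : ℝ => x) (gaussianReal 0 1) :=
      memLp_one_iff_integrable.1 (memLp_id_gaussianReal 1)
    rw [lintegral_add_left (by fun_prop)]
    exact ENNReal.add_ne_top.2 ⟨(hid.comp_fst _).2.ne, (hid.comp_snd _).2.ne⟩
  set K := ∫⁻ p : ℝ × ℝ, (‖p.1‖ₑ + ‖p.2‖ₑ) ∂(gaussianReal 0 1).prod (gaussianReal 0 1)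
  have hmeas : ∀ n : ℕ+, Measurable fun a => mode a n := fun n => by
    unfold mode
    fun_prop
  have hmode : ∀ n : ℕ+, ∫⁻ a, ‖mode a n‖ₑ ∂circleMeasure ≤ K := fun n => by
    have hpres := measurePreserving_eval_infinitePi
      (fun _ : ℕ+ => (gaussianReal 0 1).prod (gaussianReal 0 1)) n
    calc ∫⁻ a, ‖mode a n‖ₑ ∂circleMeasure
        ≤ ∫⁻ a, (‖(a n).1‖ₑ + ‖(a n).2‖ₑ) ∂circleMeasure := by
          refine lintegral_mono fun a => ?_
          have h := norm_mode_le a n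
          rw [← ofReal_norm, ← ofReal_norm, ← ofReal_norm,
            ← ENNReal.ofReal_add (norm_nonneg _) (norm_nonneg _)]
          exact ENNReal.ofReal_le_ofReal h
      _ = K := hpres.lintegral_comp (f := fun p : ℝ × ℝ => ‖p.1‖ₑ + ‖p.2‖ₑ) (by fun_prop)
  have hone : ∀ r : ℝ, 0 < r → r < 1 →
      ∀ᵐ a ∂circleMeasure, Summable fun n : ℕ+ => ‖mode a n‖ * r ^ (n : ℕ) := by
    intro r hr0 hr1
    have hgeo : Summable fun n : ℕ+ => r ^ (n : ℕ) :=
      (summable_geometric_of_lt_one hr0.le hr1).comp_injective PNat.coe_injective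
    have hfin : ∫⁻ a, ∑' n : ℕ+, ‖mode a n * (r : ℂ) ^ (n : ℕ)‖ₑ ∂circleMeasure ≠ ⊤ := by
      have hm : ∀ n : ℕ+, Measurable fun a => ‖mode a n * (r : ℂ) ^ (n : ℕ)‖ₑ := fun n =>
        ((hmeas n).mul_const _).enorm
      rw [lintegral_tsum fun n => (hm n).aemeasurable]
      refine ne_top_of_le_ne_top (ENNReal.mul_ne_top hK hgeo.tsum_ofReal_ne_top) ?_
      rw [← ENNReal.tsum_mul_left]
      refine ENNReal.tsum_le_tsum fun n => ?_
      simp_rw [enorm_mul]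
      rw [lintegral_mul_const _ (hmeas n).enorm, ← ofReal_norm ((r : ℂ) ^ (n : ℕ)), norm_pow,
        Complex.norm_real, Real.norm_of_nonneg hr0.le]
      gcongr
      exact hmode n
    filter_upwards [ae_lt_top' (Measurable.aemeasurable (Measurable.tsum fun n =>
      ((hmeas n).mul_const _).enorm)) hfin] with a ha
    have := (tsum_enorm_ne_top_iff_summable_norm).1 ha.ne
    refine this.congr fun n => ?_
    rw [norm_mul, norm_pow, Complex.norm_real, Real.norm_of_nonneg hr0.le]
  have hall : ∀ᵐ a ∂circleMeasure, ∀ k : ℕ,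
      Summable fun n : ℕ+ => ‖mode a n‖ * (1 - 1 / ((k : ℝ) + 2)) ^ (n : ℕ) := by
    rw [ae_all_iff]
    intro k
    have h2 : 1 / ((k : ℝ) + 2) < 1 := (div_lt_one (by positivity)).2 (by linarith [k.cast_nonneg (α := ℝ)])
    exact hone _ (by linarith) (by linarith [show 0 < 1 / ((k : ℝ) + 2) by positivity])
  filter_upwards [hall] with a ha r hr0 hr1
  obtain ⟨k, hk⟩ := exists_nat_one_div_lt (sub_pos.2 hr1)
  refine Summable.of_nonneg_of_le (fun n => by positivity) (fun n => ?_) (ha k)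
  have hle : 1 / ((k : ℝ) + 2) ≤ 1 / ((k : ℝ) + 1) := by gcongr; norm_num
  gcongr
  linarith

lemma ModesSummable.summable_norm {a : CircleModes} (ha : ModesSummable a) {m : ℕ+ → ℂ}
    (hm : GeometricDecay m) : Summable fun n => ‖2 * mode a n * conj (m n)‖ := by
  obtain ⟨r, C, hr0, hr1, hC, h⟩ := hm
  refine Summable.of_nonneg_of_le (fun n => norm_nonneg _) (fun n => ?_)
    ((ha r hr0 hr1).mul_left (2 * C))
  rw [norm_mul, norm_mul, RCLike.norm_conj, Complex.norm_ofNat]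
  calc 2 * ‖mode a n‖ * ‖m n‖ ≤ 2 * ‖mode a n‖ * (C * r ^ (n : ℕ)) := by gcongr; exact h n
    _ = 2 * C * (‖mode a n‖ * r ^ (n : ℕ)) := by ring

lemma ModesSummable.summable {a : CircleModes} (ha : ModesSummable a) {m : ℕ+ → ℂ}
    (hm : GeometricDecay m) : Summable (modePair a m) :=
  Summable.of_norm_bounded (ha.summable_norm hm) fun _ => Complex.abs_re_le_norm _

lemma ModesSummable.harmonicExt_eq {a : CircleModes} (ha : ModesSummable a) {z : ℂ}
    (hz : ‖z‖ < 1) : harmonicExt a z = modeSum a fun n => z ^ (n : ℕ) := by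
  have hs := (ha.summable_norm (geometricDecay_pow hz)).of_norm
  have hre : ∀ n : ℕ+, (mode a n * conj z ^ (n : ℕ) + conj (mode a n) * z ^ (n : ℕ))
      = (((modePair a (fun n => z ^ (n : ℕ)) n : ℝ)) : ℂ) := fun n => by
    have h2 : ∀ w : ℂ, (2 * w).re = 2 * w.re := fun w => by simp
    rw [modePair, mul_assoc, h2]
    have h := Complex.add_conj (mode a n * conj (z ^ (n : ℕ)))
    rw [map_mul, Complex.conj_conj, map_pow] at h
    rw [map_pow, h]
  rw [harmonicExt, if_pos hz, harmonicSeries]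
  simp_rw [hre]
  rw [← Complex.ofReal_tsum, Complex.ofReal_re, modeSum]

/-- The harmonic extension pairs with a density in the disc through the moments. -/
lemma ModesSummable.ofFun_harmonicExt {a : CircleModes} (ha : ModesSummable a)
    (f : DiscDensity) : ofFun (harmonicExt a) f.1 = modeSum a (moment f.1) := by
  have hb : ∀ r : ℝ, 0 < r → r < 1 → Summable fun n : ℕ+ => ‖2 * mode a n‖ * r ^ (n : ℕ) :=
    fun r hr0 hr1 => by
      simpa [mul_assoc] using (ha r hr0 hr1).mul_left 2
  have h := hasSum_integral_modes hb f
  rw [modeSum, ofFun]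
  refine Eq.trans ?_ h.tsum_eq.symm
  refine integral_congr_disc (s := ∅) (by simp) fun z _ hz => ?_
  rw [ha.harmonicExt_eq hz, modeSum]
  simp_rw [modePair, map_pow]

lemma summable_modeCov {m m' : ℕ+ → ℂ} (hm : GeometricDecay m) (hm' : GeometricDecay m') :
    Summable fun n : ℕ+ => (m n * conj (m' n)).re / (n : ℕ) := by
  obtain ⟨r, C, hr0, hr1, hC, h⟩ := hm
  obtain ⟨s, D, hs0, hs1, hD, h'⟩ := hm'
  refine Summable.of_norm_bounded
    (((summable_geometric_of_lt_one hr0.le hr1).comp_injective PNat.coe_injective).mul_left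
      (C * D)) fun n => ?_
  rw [norm_div, Real.norm_natCast]
  calc ‖(m n * conj (m' n)).re‖ / (n : ℕ) ≤ ‖(m n * conj (m' n)).re‖ :=
        div_le_self (norm_nonneg _) (by exact_mod_cast n.pos)
    _ ≤ ‖m n‖ * ‖m' n‖ := by
        refine (Complex.abs_re_le_norm _).trans ?_
        rw [norm_mul, RCLike.norm_conj]
    _ ≤ (C * r ^ (n : ℕ)) * (D * 1) := by
        gcongr
        · exact h n
        · exact (h' n).trans (by gcongr; exact pow_le_one₀ hs0.le hs1.le)
    _ = _ := by simp; ring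

lemma modeCov_comm (m m' : ℕ+ → ℂ) : modeCov m m' = modeCov m' m := by
  refine tsum_congr fun n => ?_
  rw [← Complex.conj_re, map_mul, Complex.conj_conj, mul_comm]

lemma geometricDecay_sum {ι : Type*} {m : ι → ℕ+ → ℂ} (hm : ∀ i, GeometricDecay (m i))
    (I : Finset ι) (s : ι → ℝ) : GeometricDecay fun n => ∑ i ∈ I, (s i : ℂ) * m i n := by
  classical
  induction I using Finset.induction_on with
  | empty => exact ⟨1 / 2, 0, by norm_num, by norm_num, le_rfl, by simp⟩
  | insert i I hi ih =>
    obtain ⟨r, C, hr0, hr1, hC, h⟩ := hm i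
    obtain ⟨t, D, ht0, ht1, hD, h'⟩ := ih
    refine ⟨max r t, |s i| * C + D, by positivity, max_lt hr1 ht1, by positivity, fun n => ?_⟩
    simp only [Finset.sum_insert hi, add_mul]
    refine (norm_add_le _ _).trans (add_le_add ?_ ((h' n).trans ?_))
    · rw [norm_mul, Complex.norm_real, Real.norm_eq_abs, mul_assoc]
      gcongr
      refine (h n).trans ?_
      gcongr
      exact le_max_left _ _
    · gcongr
      exact le_max_right _ _

lemma ModesSummable.modeSum_sum {a : CircleModes} (ha : ModesSummable a) {ι : Type*}
    {m : ι → ℕ+ → ℂ} (hm : ∀ i, GeometricDecay (m i)) (I : Finset ι) (s : ι → ℝ) :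
    ∑ i ∈ I, s i * modeSum a (m i) = modeSum a fun n => ∑ i ∈ I, (s i : ℂ) * m i n := by
  simp_rw [modeSum, ← tsum_mul_left]
  rw [← Summable.tsum_finsetSum fun i _ => (ha.summable (hm i)).mul_left (s i)]
  refine tsum_congr fun n => ?_
  simp_rw [modePair, map_sum, Finset.mul_sum, Complex.re_sum]
  refine Finset.sum_congr rfl fun i _ => ?_
  rw [map_mul, Complex.conj_ofReal, mul_left_comm, Complex.re_ofReal_mul]

lemma modeCov_sum {ι : Type*} {m : ι → ℕ+ → ℂ} (hm : ∀ i, GeometricDecay (m i))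
    (I : Finset ι) (s : ι → ℝ) :
    modeCov (fun n => ∑ i ∈ I, (s i : ℂ) * m i n) (fun n => ∑ i ∈ I, (s i : ℂ) * m i n)
      = quadForm (fun i j => modeCov (m i) (m j)) I s := by
  simp_rw [quadForm, modeCov, ← tsum_mul_left]
  rw [Finset.sum_congr rfl fun i _ => (Summable.tsum_finsetSum fun j _ =>
    (summable_modeCov (hm i) (hm j)).mul_left (s i * s j)).symm,
    ← Summable.tsum_finsetSum fun i _ => summable_sum fun j _ =>
      (summable_modeCov (hm i) (hm j)).mul_left (s i * s j)]
  refine tsum_congr fun n => ?_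
  simp_rw [map_sum, Finset.sum_mul_sum, Complex.re_sum, Finset.sum_div]
  refine Finset.sum_congr rfl fun i _ => Finset.sum_congr rfl fun j _ => ?_
  rw [map_mul, Complex.conj_ofReal,
    show (s i : ℂ) * m i n * ((s j : ℂ) * conj (m j n))
      = ((s i * s j : ℝ) : ℂ) * (m i n * conj (m j n)) by push_cast; ring, Complex.re_ofReal_mul,
    mul_div_assoc]

lemma integral_cexp_finset_modePair (m : ℕ+ → ℂ) (s : Finset ℕ+) :
    ∫ a, Complex.exp (Complex.I * ((∑ n ∈ s, modePair a m n : ℝ) : ℂ)) ∂circleMeasure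
      = ((Real.exp (∑ n ∈ s, -((m n * conj (m n)).re / (n : ℕ)) / 2) : ℝ) : ℂ) := by
  have hone : ∀ x y : ℝ, ∫ p : ℝ × ℝ, Complex.exp (Complex.I * ((p.1 * x + p.2 * y : ℝ) : ℂ))
      ∂(gaussianReal 0 1).prod (gaussianReal 0 1)
      = Complex.exp (-((x ^ 2 + y ^ 2 : ℝ) : ℂ) / 2) := fun x y => by
    have hG : ∀ x : ℝ, ∫ u : ℝ, Complex.exp (Complex.I * x * (u : ℂ)) ∂gaussianReal 0 1
        = Complex.exp (-(x : ℂ) ^ 2 / 2) := fun x => by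
      rw [integral_cexp_mul (μ := gaussianReal 0 1) (Y := fun u => u) (v := 1) Measure.map_id,
        mul_pow, Complex.I_sq]
      simp
    have hsplit : ∀ p : ℝ × ℝ, Complex.exp (Complex.I * ((p.1 * x + p.2 * y : ℝ) : ℂ))
        = Complex.exp (Complex.I * x * (p.1 : ℂ)) * Complex.exp (Complex.I * y * (p.2 : ℂ)) :=
      fun p => by
        rw [← Complex.exp_add]
        congr 1
        push_cast
        ring
    simp_rw [hsplit]
    rw [integral_prod_mul (fun u : ℝ => Complex.exp (Complex.I * x * (u : ℂ)))
      (fun u : ℝ => Complex.exp (Complex.I * y * (u : ℂ))), hG, hG, ← Complex.exp_add]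
    congr 1
    push_cast
    ring
  have hterm : ∀ a : CircleModes,
      Complex.exp (Complex.I * ((∑ n ∈ s, modePair a m n : ℝ) : ℂ))
        = ∏ n : s, Complex.exp (Complex.I * (((s.restrict a n).1 * ((m n).re / Real.sqrt (n : ℕ+))
          + (s.restrict a n).2 * ((m n).im / Real.sqrt (n : ℕ+)) : ℝ) : ℂ)) := fun a => by
    rw [← Complex.exp_sum, ← Finset.sum_coe_sort s, Complex.ofReal_sum, Finset.mul_sum]
    congr 1
    refine Finset.sum_congr rfl fun n _ => ?_
    rw [modePair_eq]
    congr 2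
    simp only [Finset.restrict]
    ring
  simp_rw [hterm]
  refine (integral_restrict_infinitePi (X := fun _ : ℕ+ => ℝ × ℝ)
    (μ := fun _ : ℕ+ => (gaussianReal 0 1).prod (gaussianReal 0 1))
    (f := fun y : s → ℝ × ℝ => ∏ n : s, Complex.exp (Complex.I *
      (((y n).1 * ((m n).re / Real.sqrt (n : ℕ+)) + (y n).2 * ((m n).im / Real.sqrt (n : ℕ+)) : ℝ)
        : ℂ))) (by fun_prop)).trans ?_
  rw [integral_fintype_prod_eq_prod (fun (n : s) (p : ℝ × ℝ) => Complex.exp (Complex.I *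
      ((p.1 * ((m n).re / Real.sqrt (n : ℕ+)) + p.2 * ((m n).im / Real.sqrt (n : ℕ+)) : ℝ) : ℂ)))]
  simp_rw [hone]
  rw [← Complex.exp_sum, Finset.sum_coe_sort s fun n : ℕ+ =>
    -((((m n).re / Real.sqrt (n : ℕ)) ^ 2 + ((m n).im / Real.sqrt (n : ℕ)) ^ 2 : ℝ) : ℂ) / 2,
    Complex.ofReal_exp, Complex.ofReal_sum]
  congr 1
  refine Finset.sum_congr rfl fun n _ => ?_
  rw [div_pow, div_pow, Real.sq_sqrt (by positivity), Complex.mul_conj, Complex.ofReal_re,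
    Complex.normSq_apply]
  push_cast
  ring

/-- The harmonic field is Gaussian with covariance `modeCov`. -/
lemma integral_cexp_modeSum {m : ℕ+ → ℂ} (hm : GeometricDecay m) :
    ∫ a, Complex.exp (Complex.I * (modeSum a m : ℂ)) ∂circleMeasure
      = Complex.exp (-(modeCov m m : ℂ) / 2) := by
  have h1 : Tendsto (fun s : Finset ℕ+ =>
      ∫ a, Complex.exp (Complex.I * ((∑ n ∈ s, modePair a m n : ℝ) : ℂ)) ∂circleMeasure) atTop
      (𝓝 (∫ a, Complex.exp (Complex.I * (modeSum a m : ℂ)) ∂circleMeasure)) := by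
    refine tendsto_integral_filter_of_dominated_convergence (fun _ => (1 : ℝ))
      (Eventually.of_forall fun s => ?_) (Eventually.of_forall fun s => ae_of_all _ fun a => ?_)
      (integrable_const _) ?_
    · have : Measurable fun a => ∑ n ∈ s, modePair a m n :=
        Finset.measurable_sum s fun n _ => measurable_modePair m n
      exact (Complex.measurable_exp.comp
        ((Complex.measurable_ofReal.comp this).const_mul _)).aestronglyMeasurable
    · rw [mul_comm, Complex.norm_exp_ofReal_mul_I]
    · filter_upwards [ae_modesSummable] with a ha
      have hs : Tendsto (fun s : Finset ℕ+ => ∑ n ∈ s, modePair a m n) atTop (𝓝 (modeSum a m)) :=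
        (ha.summable hm).hasSum
      have hc : Continuous fun x : ℝ => Complex.exp (Complex.I * (x : ℂ)) := by fun_prop
      exact (hc.tendsto _).comp hs
  have h2 : Tendsto (fun s : Finset ℕ+ =>
      ((Real.exp (∑ n ∈ s, -((m n * conj (m n)).re / (n : ℕ)) / 2) : ℝ) : ℂ)) atTop
      (𝓝 ((Real.exp (-modeCov m m / 2) : ℝ) : ℂ)) := by
    have hs : HasSum (fun n : ℕ+ => -((m n * conj (m n)).re / (n : ℕ)) / 2) (-modeCov m m / 2) :=
      (summable_modeCov hm hm).hasSum.neg.div_const 2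
    have hc : Continuous fun x : ℝ => ((Real.exp x : ℝ) : ℂ) := by fun_prop
    exact (hc.tendsto _).comp hs
  simp_rw [integral_cexp_finset_modePair] at h1
  rw [tendsto_nhds_unique h1 h2]
  push_cast
  rfl

lemma modeCov_self_nonneg (m : ℕ+ → ℂ) : 0 ≤ modeCov m m :=
  tsum_nonneg fun n => by
    rw [Complex.mul_conj, Complex.ofReal_re]
    exact div_nonneg (Complex.normSq_nonneg _) (by positivity)

lemma map_modeSum {m : ℕ+ → ℂ} (hm : GeometricDecay m) :
    circleMeasure.map (fun a => modeSum a m) = gaussianReal 0 (modeCov m m).toNNReal := by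
  refine Measure.ext_of_charFun ?_
  ext t
  rw [charFun_gaussianReal, charFun_apply_real, integral_map (by fun_prop) (by fun_prop),
    Real.coe_toNNReal _ (modeCov_self_nonneg m)]
  have hdec : GeometricDecay fun n => (t : ℂ) * m n := by
    simpa using geometricDecay_sum (fun _ : Unit => hm) {()} fun _ => t
  have h := integral_cexp_modeSum hdec
  have hcov := modeCov_sum (fun _ : Unit => hm) {()} fun _ => t
  simp only [Finset.sum_singleton, quadForm] at hcov
  rw [hcov] at h
  rw [show Complex.exp ((t : ℂ) * ((0 : ℝ) : ℂ) * Complex.I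
      - ((modeCov m m : ℝ) : ℂ) * (t : ℂ) ^ 2 / 2)
      = Complex.exp (-((t * t * modeCov m m : ℝ) : ℂ) / 2) by congr 1; push_cast; ring, ← h]
  refine integral_congr_ae ?_
  filter_upwards [ae_modesSummable] with a ha
  have := ha.modeSum_sum (fun _ : Unit => hm) {()} fun _ => t
  simp only [Finset.sum_singleton] at this
  rw [← this]
  congr 1
  push_cast
  ring

lemma integral_modeSum_sq {m : ℕ+ → ℂ} (hm : GeometricDecay m) :
    ∫ a, modeSum a m ^ 2 ∂circleMeasure = modeCov m m := by
  have h : ∫ x, x ^ 2 ∂(circleMeasure.map fun a => modeSum a m) = modeCov m m := by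
    rw [map_modeSum hm]
    have := variance_id_gaussianReal (μ := 0) (v := (modeCov m m).toNNReal)
    rw [variance_of_integral_eq_zero (by fun_prop) (by simp),
      Real.coe_toNNReal _ (modeCov_self_nonneg m)] at this
    exact this
  rw [← h, integral_map (by fun_prop) (by fun_prop)]

/-! ### The Markov decomposition of the free field -/

/-- The restriction of a field to the test densities supported in the disc. -/
def restrictDisc (φ : Config) : DiscDensity → ℝ := fun f => φ f.1

/-- Restrictions of a field and of its reflection to the disc. -/
def sphereHalves (φ : Config) : DiscDensity ⊕ DiscDensity → ℝ :=
  Sum.elim (restrictDisc φ) (restrictDisc (theta φ))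

/-- The restriction to the disc of `X + P φ`, where `a` are the modes of `φ`. -/
def discHalf (a : CircleModes) (X : Config) : DiscDensity → ℝ :=
  fun f => X f.1 + modeSum a (moment f.1)

/-- Two fields on the disc with a common harmonic part. -/
def discHalves (q : CircleModes × Config × Config) : DiscDensity ⊕ DiscDensity → ℝ :=
  Sum.elim (discHalf q.1 q.2.1) (discHalf q.1 q.2.2)

section Law

variable {Ω Ω' : Type*} [MeasurableSpace Ω] [MeasurableSpace Ω'] {μ : Measure Ω}
  {μD : Measure Ω'} {Φ : Ω → Config} {ΦD : Ω' → Config}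

lemma measurable_sphereHalves (hΦ : IsFreeField μ Φ) :
    Measurable fun x => sphereHalves (Φ x) := by
  refine measurable_pi_iff.2 ?_
  rintro (f | f)
  · exact hΦ.measurable_eval f.1
  · exact hΦ.measurable_eval f.1.refl

lemma measurable_discHalf (hΦD : IsDirichletField μD ΦD) :
    Measurable fun q : CircleModes × Ω' => discHalf q.1 (ΦD q.2) := by
  refine measurable_pi_iff.2 fun f => ?_
  exact ((hΦD.measurable_eval f.1).comp measurable_snd).add
    ((measurable_modeSum _).comp measurable_fst)

lemma measurable_discHalves (hΦD : IsDirichletField μD ΦD) :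
    Measurable fun q : CircleModes × Ω' × Ω' => discHalves (q.1, ΦD q.2.1, ΦD q.2.2) := by
  have h := measurable_pi_iff.1 (measurable_discHalf hΦD)
  refine measurable_pi_iff.2 ?_
  rintro (f | f)
  · exact (h f).comp (measurable_fst.prodMk (measurable_fst.comp measurable_snd))
  · exact (h f).comp (measurable_fst.prodMk (measurable_snd.comp measurable_snd))

lemma quadForm_mul {ι : Type*} (C : ι → ι → ℝ) (I : Finset ι) (s u : ι → ℝ) :
    quadForm C I (fun i => s i * u i) = quadForm (fun i j => u i * u j * C i j) I s :=
  Finset.sum_congr rfl fun i _ => Finset.sum_congr rfl fun j _ => by ring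

lemma quadForm_add {ι : Type*} (C C' : ι → ι → ℝ) (I : Finset ι) (s : ι → ℝ) :
    quadForm (fun i j => C i j + C' i j) I s = quadForm C I s + quadForm C' I s := by
  simp_rw [quadForm, mul_add, Finset.sum_add_distrib]

/-- The free field and its reflection, restricted to the disc, are two independent Dirichlet fields
plus a common independent harmonic field. -/
theorem map_sphereHalves_eq [IsProbabilityMeasure μ] [IsProbabilityMeasure μD]
    (hΦ : IsFreeField μ Φ) (hΦD : IsDirichletField μD ΦD) :
    μ.map (fun x => sphereHalves (Φ x)) = (circleMeasure.prod (μD.prod μD)).map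
      fun q => discHalves (q.1, ΦD q.2.1, ΦD q.2.2) := by
  have hm1 := measurable_sphereHalves hΦ
  have hm2 := measurable_discHalves hΦD
  have := Measure.isProbabilityMeasure_map (μ := μ) hm1.aemeasurable
  have := Measure.isProbabilityMeasure_map (μ := circleMeasure.prod (μD.prod μD)) hm2.aemeasurable
  refine measure_ext_of_charFun fun I s => ?_
  have hcont : Measurable fun y : DiscDensity ⊕ DiscDensity → ℝ =>
      Complex.exp (Complex.I * ((∑ t ∈ I, s t * y t : ℝ) : ℂ)) := by fun_prop
  rw [integral_map hm1.aemeasurable hcont.aestronglyMeasurable,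
    integral_map hm2.aemeasurable hcont.aestronglyMeasurable]
  -- the underlying density of an index, and indicators of the two halves
  let d : DiscDensity ⊕ DiscDensity → DiscDensity := Sum.elim id id
  let e : DiscDensity ⊕ DiscDensity → SphereDensity := Sum.elim (fun f => f.1) fun f => f.1.refl
  let u : DiscDensity ⊕ DiscDensity → ℝ := Sum.elim (fun _ => 1) fun _ => 0
  let v : DiscDensity ⊕ DiscDensity → ℝ := Sum.elim (fun _ => 0) fun _ => 1
  have hdec : ∀ t, GeometricDecay (moment (d t).1) := fun t => geometricDecay_moment _
  have hL : ∀ x, ∑ t ∈ I, s t * sphereHalves (Φ x) t = ∑ t ∈ I, s t * Φ x (e t) := fun x => by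
    refine Finset.sum_congr rfl fun t _ => ?_
    cases t <;> rfl
  have hR : ∀ᵐ q ∂circleMeasure.prod (μD.prod μD),
      Complex.exp (Complex.I * ((∑ t ∈ I, s t * discHalves (q.1, ΦD q.2.1, ΦD q.2.2) t : ℝ) : ℂ))
        = Complex.exp (Complex.I *
            ((modeSum q.1 fun n => ∑ t ∈ I, (s t : ℂ) * moment (d t).1 n : ℝ) : ℂ))
          * (Complex.exp (Complex.I * ((∑ t ∈ I, s t * u t * ΦD q.2.1 (d t).1 : ℝ) : ℂ))
          * Complex.exp (Complex.I * ((∑ t ∈ I, s t * v t * ΦD q.2.2 (d t).1 : ℝ) : ℂ))) := by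
    filter_upwards [Measure.quasiMeasurePreserving_fst.ae ae_modesSummable] with q hq
    rw [← hq.modeSum_sum hdec, ← Complex.exp_add, ← Complex.exp_add, ← mul_add, ← mul_add,
      ← Complex.ofReal_add, ← Complex.ofReal_add, ← Finset.sum_add_distrib,
      ← Finset.sum_add_distrib]
    congr 3
    refine Finset.sum_congr rfl fun t _ => ?_
    cases t <;> simp [discHalves, discHalf, d, u, v] <;> ring
  simp_rw [hL]
  rw [integral_congr_ae hR, integral_prod_mul (fun a => Complex.exp (Complex.I *
      ((modeSum a fun n => ∑ t ∈ I, (s t : ℂ) * moment (d t).1 n : ℝ) : ℂ)))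
    (fun q : Ω' × Ω' => Complex.exp (Complex.I * ((∑ t ∈ I, s t * u t * ΦD q.1 (d t).1 : ℝ) : ℂ))
      * Complex.exp (Complex.I * ((∑ t ∈ I, s t * v t * ΦD q.2 (d t).1 : ℝ) : ℂ))),
    integral_prod_mul (fun x => Complex.exp (Complex.I *
      ((∑ t ∈ I, s t * u t * ΦD x (d t).1 : ℝ) : ℂ)))
    (fun x => Complex.exp (Complex.I * ((∑ t ∈ I, s t * v t * ΦD x (d t).1 : ℝ) : ℂ))),
    hΦ.integral_cexp_sum e I s, hΦD.integral_cexp_sum (fun t => (d t).1) I fun t => s t * u t,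
    hΦD.integral_cexp_sum (fun t => (d t).1) I fun t => s t * v t,
    integral_cexp_modeSum (geometricDecay_sum hdec I s), modeCov_sum hdec, ← Complex.exp_add,
    ← Complex.exp_add, quadForm_mul, quadForm_mul]
  have hcov : quadForm (fun i j => ∫ z, ∫ w, greenSphere z w * (e i).toFun z * (e j).toFun w) I s
      = quadForm (fun i j => modeCov (moment (d i).1) (moment (d j).1)) I s
        + (quadForm (fun i j => u i * u j * ∫ z in disc, ∫ w in disc,
            greenDisc z w * (d i).1.toFun z * (d j).1.toFun w) I s
          + quadForm (fun i j => v i * v j * ∫ z in disc, ∫ w in disc,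
            greenDisc z w * (d i).1.toFun z * (d j).1.toFun w) I s) := by
    rw [← quadForm_add, ← quadForm_add]
    refine Finset.sum_congr rfl fun i _ => Finset.sum_congr rfl fun j _ => ?_
    congr 1
    rcases i with f | f <;> rcases j with g | g
    · simp only [e, d, u, v, Sum.elim_inl, id]
      rw [sphereCov_inside]
      ring
    · simp only [e, d, u, v, Sum.elim_inl, Sum.elim_inr, id]
      rw [sphereCov_inside_refl]
      ring
    · simp only [e, d, u, v, Sum.elim_inl, Sum.elim_inr, id]
      rw [← hΦ.covariance_eq]
      simp_rw [mul_comm (Φ _ f.1.refl)]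
      rw [hΦ.covariance_eq, sphereCov_inside_refl, modeCov_comm]
      ring
    · simp only [e, d, u, v, Sum.elim_inr, id]
      rw [sphereCov_refl_refl, sphereCov_inside]
      ring
  rw [hcov]
  congr 1
  push_cast
  ring

end Law

/-! ### Functionals of the field in the disc -/

lemma fieldSigma_disc : fieldSigma disc = MeasurableSpace.comap restrictDisc MeasurableSpace.pi := by
  rw [MeasurableSpace.pi, MeasurableSpace.comap_iSup, fieldSigma, iSup_subtype']
  refine iSup_congr fun f => ?_
  rw [MeasurableSpace.comap_comp]
  rfl

/-- Functionals measurable in the disc are the measurable functions of the field restricted to the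
disc. -/
lemma measurable_fieldSigma_disc_iff {F : Config → ℂ} :
    Measurable[fieldSigma disc] F ↔
      ∃ H : (DiscDensity → ℝ) → ℂ, Measurable H ∧ F = H ∘ restrictDisc := by
  rw [fieldSigma_disc]
  constructor
  · exact fun h => h.exists_eq_measurable_comp
  · rintro ⟨H, hH, rfl⟩
    exact hH.comp (comap_measurable _)

/-- Addition of the constant field `c`. -/
def shift (c : ℝ) (v : DiscDensity → ℝ) : DiscDensity → ℝ := fun f => c * mass f.1 + v f

lemma ofFun_const (c : ℝ) (f : SphereDensity) : ofFun (fun _ => c) f = c * mass f :=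
  integral_const_mul _ _

lemma restrictDisc_fullField (Q c : ℝ) (φ : Config) :
    restrictDisc (fullField Q c φ) = shift c (restrictDisc φ) := by
  funext f
  have hk : ofFun (fun z => 2 * Q * kFun z) f.1 = 0 := by
    rw [ofFun, integral_congr_disc (v := fun _ => 0) (s := ∅) (by simp)]
    · simp
    · intro z _ hz
      rw [kFun_of_norm_lt_one hz, mul_zero]
  simp only [restrictDisc, fullField, Pi.add_apply, hk, ofFun_const, shift]
  ring

lemma restrictDisc_theta_fullField (Q c : ℝ) (φ : Config) :
    restrictDisc (theta (fullField Q c φ) - ofFun fun z => 2 * Q * Real.log ‖z‖)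
      = shift c (restrictDisc (theta φ)) := by
  funext f
  have hk : ofFun (fun z => 2 * Q * kFun z) f.1.refl
      = ofFun (fun z => 2 * Q * Real.log ‖z‖) f.1 := by
    rw [ofFun, integral_mul_refl f.1 fun z => 2 * Q * kFun z, ofFun]
    refine integral_congr_disc (s := {0}) (ae_ne 0) fun z hz0 hz => ?_
    rw [kFun_inv_conj hz0 hz]
  simp only [restrictDisc, theta, fullField, Pi.add_apply, Pi.sub_apply, hk, ofFun_const, shift,
    mass_refl]
  ring

lemma restrictDisc_discField {p : ℝ × CircleModes} (hp : ModesSummable p.2) (X : Config) :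
    restrictDisc (discField p X) = shift p.1 (discHalf p.2 X) := by
  funext f
  simp only [restrictDisc, discField, Pi.add_apply, ofFun_const, shift, discHalf,
    hp.ofFun_harmonicExt]
  ring

lemma ae_target_modesSummable : ∀ᵐ p ∂targetMeasure, ModesSummable p.2 :=
  Measure.quasiMeasurePreserving_snd.ae ae_modesSummable

instance : SFinite targetMeasure := by
  unfold targetMeasure
  infer_instance

section Operators

variable {Ω Ω' : Type*} [MeasurableSpace Ω] [MeasurableSpace Ω'] {μ : Measure Ω}
  {μD : Measure Ω'} {Φ : Ω → Config} {ΦD : Ω' → Config}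

lemma measurable_shift_discHalf (hΦD : IsDirichletField μD ΦD) :
    Measurable fun q : (ℝ × CircleModes) × Ω' => shift q.1.1 (discHalf q.1.2 (ΦD q.2)) := by
  have h := measurable_pi_iff.1 (measurable_discHalf hΦD)
  refine measurable_pi_iff.2 fun f => ?_
  exact ((measurable_fst.comp measurable_fst).mul_const _).add
    ((h f).comp ((measurable_snd.comp measurable_fst).prodMk measurable_snd))

/-- The weighted first moment `exp (-Q c) 𝔼_𝔻 |F (c + Φ_𝔻 + P φ)|`. -/
def absMap (Q : ℝ) (μD : Measure Ω') (ΦD : Ω' → Config) (F : Config → ℂ) (p : ℝ × CircleModes) :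
    ENNReal :=
  ENNReal.ofReal (Real.exp (-Q * p.1)) * ∫⁻ x, ‖F (discField p (ΦD x))‖ₑ ∂μD

lemma aemeasurable_absMap [SFinite μD] (hΦD : IsDirichletField μD ΦD) (Q : ℝ) {F : Config → ℂ}
    (hF : Measurable[fieldSigma disc] F) : AEMeasurable (absMap Q μD ΦD F) targetMeasure := by
  obtain ⟨H, hH, rfl⟩ := measurable_fieldSigma_disc_iff.1 hF
  have h1 : Measurable fun p : ℝ × CircleModes => ENNReal.ofReal (Real.exp (-Q * p.1))
      * ∫⁻ x, ‖H (shift p.1 (discHalf p.2 (ΦD x)))‖ₑ ∂μD :=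
    Measurable.mul (by fun_prop)
      (Measurable.lintegral_prod_right' (hH.comp (measurable_shift_discHalf hΦD)).enorm)
  refine ⟨_, h1, ?_⟩
  filter_upwards [ae_target_modesSummable] with p hp
  simp_rw [absMap, Function.comp_apply, restrictDisc_discField hp]

lemma absMap_add_le (hΦD : IsDirichletField μD ΦD) (Q : ℝ) {F : Config → ℂ} (G : Config → ℂ)
    (hF : Measurable[fieldSigma disc] F) :
    ∀ᵐ p ∂targetMeasure, absMap Q μD ΦD (F + G) p
      ≤ absMap Q μD ΦD F p + absMap Q μD ΦD G p := by
  obtain ⟨H, hH, rfl⟩ := measurable_fieldSigma_disc_iff.1 hF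
  filter_upwards [ae_target_modesSummable] with p hp
  have hHp : Measurable fun x => ‖(H ∘ restrictDisc) (discField p (ΦD x))‖ₑ := by
    simp_rw [Function.comp_apply, restrictDisc_discField hp]
    exact (hH.comp ((measurable_shift_discHalf hΦD).comp measurable_prodMk_left)).enorm
  rw [absMap, absMap, absMap, ← mul_add, ← lintegral_add_left hHp]
  gcongr with x
  exact enorm_add_le _ _

lemma aestronglyMeasurable_UMap [SFinite μD] (hΦD : IsDirichletField μD ΦD) (Q : ℝ)
    {F : Config → ℂ} (hF : Measurable[fieldSigma disc] F) :
    AEStronglyMeasurable (UMap Q μD ΦD F) targetMeasure := by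
  obtain ⟨H, hH, rfl⟩ := measurable_fieldSigma_disc_iff.1 hF
  have h1 : StronglyMeasurable fun p : ℝ × CircleModes => (Real.exp (-Q * p.1) : ℂ)
      * ∫ x, H (shift p.1 (discHalf p.2 (ΦD x))) ∂μD :=
    StronglyMeasurable.mul (Measurable.stronglyMeasurable (by fun_prop))
      (StronglyMeasurable.integral_prod_right'
        (hH.comp (measurable_shift_discHalf hΦD)).stronglyMeasurable)
  refine ⟨_, h1, ?_⟩
  filter_upwards [ae_target_modesSummable] with p hp
  simp_rw [UMap, Function.comp_apply, restrictDisc_discField hp]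

lemma enorm_UMap_le (Q : ℝ) (F : Config → ℂ) (p : ℝ × CircleModes) :
    ‖UMap Q μD ΦD F p‖ₑ ≤ absMap Q μD ΦD F p := by
  rw [UMap, absMap, enorm_mul]
  gcongr
  · rw [← ofReal_norm, Complex.norm_real, Real.norm_of_nonneg (Real.exp_pos _).le]
  · exact enorm_integral_le_lintegral_enorm _

/-- The integrand of `⟨(Θ F) G⟩` as a function of `c` and of the two halves of the field. -/
def formIntegrand (Q : ℝ) (H K : (DiscDensity → ℝ) → ℂ)
    (q : ℝ × (DiscDensity ⊕ DiscDensity → ℝ)) : ℂ :=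
  (Real.exp (-2 * Q * q.1) : ℂ) *
    (conj (H (shift q.1 fun f => q.2 (Sum.inr f))) * K (shift q.1 fun f => q.2 (Sum.inl f)))

lemma measurable_formIntegrand (Q : ℝ) {H K : (DiscDensity → ℝ) → ℂ} (hH : Measurable H)
    (hK : Measurable K) : Measurable (formIntegrand Q H K) := by
  have h1 : Measurable fun q : ℝ × (DiscDensity ⊕ DiscDensity → ℝ) =>
      shift q.1 fun f => q.2 (Sum.inr f) := measurable_pi_iff.2 fun f => by
    unfold shift
    fun_prop
  have h2 : Measurable fun q : ℝ × (DiscDensity ⊕ DiscDensity → ℝ) =>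
      shift q.1 fun f => q.2 (Sum.inl f) := measurable_pi_iff.2 fun f => by
    unfold shift
    fun_prop
  exact Measurable.mul (by fun_prop)
    ((Complex.continuous_conj.measurable.comp (hH.comp h1)).mul (hK.comp h2))

/-- The integrand of `⟨(Θ F) G⟩` only sees the two halves of `Φ`, since the background charge cancels. -/
lemma Theta_mul_fullField (Q c : ℝ) (H K : (DiscDensity → ℝ) → ℂ) (φ : Config) :
    (Real.exp (-2 * Q * c) : ℂ) * (Theta Q (H ∘ restrictDisc) (fullField Q c φ)
        * (K ∘ restrictDisc) (fullField Q c φ))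
      = formIntegrand Q H K (c, sphereHalves φ) := by
  rw [Theta, Function.comp_apply, Function.comp_apply, restrictDisc_theta_fullField,
    restrictDisc_fullField]
  rfl

lemma measurePreserving_sphere [SFinite μ] (hΦ : IsFreeField μ Φ) :
    MeasurePreserving (fun q : ℝ × Ω => (q.1, sphereHalves (Φ q.2)))
      ((volume : Measure ℝ).prod μ)
      ((volume : Measure ℝ).prod (μ.map fun x => sphereHalves (Φ x))) :=
  (MeasurePreserving.id volume).prod ⟨measurable_sphereHalves hΦ, rfl⟩

lemma measurePreserving_disc [IsProbabilityMeasure μ] [IsProbabilityMeasure μD]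
    (hΦ : IsFreeField μ Φ) (hΦD : IsDirichletField μD ΦD) :
    MeasurePreserving
      (fun q : (ℝ × CircleModes) × Ω' × Ω' =>
        (q.1.1, discHalves (q.1.2, ΦD q.2.1, ΦD q.2.2)))
      (targetMeasure.prod (μD.prod μD))
      ((volume : Measure ℝ).prod (μ.map fun x => sphereHalves (Φ x))) := by
  have h : MeasurePreserving (fun q : CircleModes × Ω' × Ω' => discHalves (q.1, ΦD q.2.1, ΦD q.2.2))
      (circleMeasure.prod (μD.prod μD)) (μ.map fun x => sphereHalves (Φ x)) :=
    ⟨measurable_discHalves hΦD, (map_sphereHalves_eq hΦ hΦD).symm⟩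
  have := Measure.isProbabilityMeasure_map (μ := μ) (measurable_sphereHalves hΦ).aemeasurable
  exact ((MeasurePreserving.id volume).prod h).comp
    (measurePreserving_prodAssoc volume circleMeasure (μD.prod μD))

lemma formIntegrand_discHalves {Q : ℝ} {H K : (DiscDensity → ℝ) → ℂ} {p : ℝ × CircleModes}
    (hp : ModesSummable p.2) (X X' : Config) :
    formIntegrand Q H K (p.1, discHalves (p.2, X, X'))
      = (Real.exp (-2 * Q * p.1) : ℂ) * (conj ((H ∘ restrictDisc) (discField p X'))
        * (K ∘ restrictDisc) (discField p X)) := by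
  rw [Function.comp_apply, Function.comp_apply, restrictDisc_discField hp,
    restrictDisc_discField hp]
  rfl

variable [IsProbabilityMeasure μ] [IsProbabilityMeasure μD]

/-- Absolute convergence of `⟨(Θ F) G⟩` in terms of the weighted first moments. -/
lemma freeIntegrable_iff (hΦ : IsFreeField μ Φ) (hΦD : IsDirichletField μD ΦD) (Q : ℝ)
    {F G : Config → ℂ} (hF : Measurable[fieldSigma disc] F) (hG : Measurable[fieldSigma disc] G) :
    FreeIntegrable Q μ Φ (fun φ => Theta Q F φ * G φ) ↔
      ∫⁻ p, absMap Q μD ΦD F p * absMap Q μD ΦD G p ∂targetMeasure < ⊤ := by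
  obtain ⟨H, hH, rfl⟩ := measurable_fieldSigma_disc_iff.1 hF
  obtain ⟨K, hK, rfl⟩ := measurable_fieldSigma_disc_iff.1 hG
  have hT := measurable_formIntegrand Q hH hK
  have hd := measurePreserving_disc hΦ hΦD
  have h1 : FreeIntegrable Q μ Φ
      (fun φ => Theta Q (H ∘ restrictDisc) φ * (K ∘ restrictDisc) φ) ↔
      ∫⁻ q, ‖formIntegrand Q H K q‖ₑ
        ∂((volume : Measure ℝ).prod (μ.map fun x => sphereHalves (Φ x))) < ⊤ := by
    unfold FreeIntegrable
    simp_rw [Theta_mul_fullField]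
    have := (measurePreserving_sphere hΦ).integrable_comp (g := formIntegrand Q H K)
      hT.aestronglyMeasurable
    refine this.trans ⟨fun h => h.2, fun h => ⟨hT.aestronglyMeasurable, h⟩⟩
  rw [h1, ← hd.lintegral_comp hT.enorm]
  have hmeas : Measurable fun q : (ℝ × CircleModes) × Ω' × Ω' =>
      ‖formIntegrand Q H K (q.1.1, discHalves (q.1.2, ΦD q.2.1, ΦD q.2.2))‖ₑ :=
    (hT.comp hd.measurable).enorm
  rw [lintegral_prod _ hmeas.aemeasurable]
  refine iff_of_eq (congrArg (fun t : ENNReal => t < ⊤) (lintegral_congr_ae ?_))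
  filter_upwards [ae_target_modesSummable] with p hp
  have hHp : Measurable fun x => ‖(H ∘ restrictDisc) (discField p (ΦD x))‖ₑ := by
    simp_rw [Function.comp_apply, restrictDisc_discField hp]
    exact (hH.comp ((measurable_shift_discHalf hΦD).comp measurable_prodMk_left)).enorm
  have hKp : Measurable fun x => ‖(K ∘ restrictDisc) (discField p (ΦD x))‖ₑ := by
    simp_rw [Function.comp_apply, restrictDisc_discField hp]
    exact (hK.comp ((measurable_shift_discHalf hΦD).comp measurable_prodMk_left)).enorm
  have hexp : ‖(Real.exp (-2 * Q * p.1) : ℂ)‖ₑ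
      = ENNReal.ofReal (Real.exp (-Q * p.1)) * ENNReal.ofReal (Real.exp (-Q * p.1)) := by
    rw [← ENNReal.ofReal_mul (Real.exp_pos _).le, ← Real.exp_add, ← ofReal_norm,
      Complex.norm_real, Real.norm_of_nonneg (Real.exp_pos _).le]
    congr 2
    ring
  simp_rw [formIntegrand_discHalves hp, enorm_mul, RCLike.enorm_conj]
  rw [lintegral_const_mul' _ _ enorm_ne_top]
  simp_rw [mul_comm ‖(H ∘ restrictDisc) (discField p (ΦD _))‖ₑ]
  rw [lintegral_prod_mul hKp.aemeasurable hHp.aemeasurable, hexp, absMap, absMap]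
  ring

/-- The reflection form is the `L²` product of the images under `U`. -/
lemma osForm_eq (hΦ : IsFreeField μ Φ) (hΦD : IsDirichletField μD ΦD) (Q : ℝ)
    {F G : Config → ℂ} (hF : Measurable[fieldSigma disc] F) (hG : Measurable[fieldSigma disc] G)
    (hFG : FreeIntegrable Q μ Φ fun φ => Theta Q F φ * G φ) :
    osForm Q μ Φ F G
      = ∫ p, conj (UMap Q μD ΦD F p) * UMap Q μD ΦD G p ∂targetMeasure := by
  obtain ⟨H, hH, rfl⟩ := measurable_fieldSigma_disc_iff.1 hF
  obtain ⟨K, hK, rfl⟩ := measurable_fieldSigma_disc_iff.1 hG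
  have hT := measurable_formIntegrand Q hH hK
  have hd := measurePreserving_disc hΦ hΦD
  have hs := measurePreserving_sphere hΦ
  unfold FreeIntegrable at hFG
  simp_rw [Theta_mul_fullField] at hFG
  have hI := (hs.integrable_comp (g := formIntegrand Q H K) hT.aestronglyMeasurable).1 hFG
  have hI' := (hd.integrable_comp (g := formIntegrand Q H K) hT.aestronglyMeasurable).2 hI
  have h1 : osForm Q μ Φ (H ∘ restrictDisc) (K ∘ restrictDisc)
      = ∫ q, formIntegrand Q H K q
        ∂((volume : Measure ℝ).prod (μ.map fun x => sphereHalves (Φ x))) := by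
    unfold osForm freeExp
    simp_rw [← integral_const_mul, Theta_mul_fullField]
    rw [← hs.map_eq, integral_map hs.measurable.aemeasurable hT.aestronglyMeasurable,
      integral_prod _ hFG]
  rw [h1, ← hd.map_eq, integral_map hd.measurable.aemeasurable hT.aestronglyMeasurable,
    integral_prod (fun q : (ℝ × CircleModes) × Ω' × Ω' =>
      formIntegrand Q H K (q.1.1, discHalves (q.1.2, ΦD q.2.1, ΦD q.2.2))) hI']
  refine integral_congr_ae ?_
  filter_upwards [ae_target_modesSummable] with p hp
  have hexp : (Real.exp (-2 * Q * p.1) : ℂ)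
      = (Real.exp (-Q * p.1) : ℂ) * (Real.exp (-Q * p.1) : ℂ) := by
    rw [← Complex.ofReal_mul, ← Real.exp_add]
    congr 2
    ring
  simp_rw [formIntegrand_discHalves hp]
  rw [integral_const_mul]
  simp_rw [mul_comm (conj ((H ∘ restrictDisc) _))]
  rw [integral_prod_mul (fun x => (K ∘ restrictDisc) (discField p (ΦD x)))
    fun x => conj ((H ∘ restrictDisc) (discField p (ΦD x))), integral_conj, hexp, UMap, UMap,
    map_mul, Complex.conj_ofReal]
  ring

lemma mem_osDomain_iff (hΦ : IsFreeField μ Φ) (hΦD : IsDirichletField μD ΦD) (Q : ℝ)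
    {F : Config → ℂ} : F ∈ osDomain Q μ Φ ↔ Measurable[fieldSigma disc] F ∧
      ∫⁻ p, absMap Q μD ΦD F p ^ 2 ∂targetMeasure < ⊤ := by
  simp_rw [sq]
  exact and_congr_right fun hF => freeIntegrable_iff hΦ hΦD Q hF hF

/-- Mixed terms converge by `x y ≤ x² + y²`. -/
lemma freeIntegrable_of_mem (hΦ : IsFreeField μ Φ) (hΦD : IsDirichletField μD ΦD) {Q : ℝ}
    {F G : Config → ℂ} (hF : F ∈ osDomain Q μ Φ) (hG : G ∈ osDomain Q μ Φ) :
    FreeIntegrable Q μ Φ fun φ => Theta Q F φ * G φ := by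
  rw [mem_osDomain_iff hΦ hΦD] at hF hG
  rw [freeIntegrable_iff hΦ hΦD Q hF.1 hG.1]
  refine lt_of_le_of_lt (lintegral_mono fun p => ?_) ((lintegral_add_left'
    ((aemeasurable_absMap hΦD Q hF.1).pow_const 2) _).trans_lt (ENNReal.add_lt_top.2 ⟨hF.2, hG.2⟩))
  rcases le_total (absMap Q μD ΦD F p) (absMap Q μD ΦD G p) with h | h
  · calc absMap Q μD ΦD F p * absMap Q μD ΦD G p ≤ absMap Q μD ΦD G p ^ 2 := by
          rw [sq]; gcongr
      _ ≤ _ := le_add_self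
  · calc absMap Q μD ΦD F p * absMap Q μD ΦD G p ≤ absMap Q μD ΦD F p ^ 2 := by
          rw [sq]; gcongr
      _ ≤ _ := le_self_add

/-- The domain of the form as a vector space. -/
def osSubmodule (hΦ : IsFreeField μ Φ) (hΦD : IsDirichletField μD ΦD) (Q : ℝ) :
    Submodule ℂ (Config → ℂ) where
  carrier := osDomain Q μ Φ
  zero_mem' := by
    rw [mem_osDomain_iff hΦ hΦD]
    exact ⟨@measurable_const _ _ _ (fieldSigma disc) 0, by simp [absMap]⟩
  add_mem' := by
    intro F G hF hG
    rw [mem_osDomain_iff hΦ hΦD] at hF hG ⊢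
    refine ⟨?_, ?_⟩
    · obtain ⟨H, hH, rfl⟩ := measurable_fieldSigma_disc_iff.1 hF.1
      obtain ⟨K, hK, rfl⟩ := measurable_fieldSigma_disc_iff.1 hG.1
      exact measurable_fieldSigma_disc_iff.2 ⟨H + K, hH.add hK, rfl⟩
    have hF2 := (aemeasurable_absMap hΦD Q hF.1).pow_const 2
    calc ∫⁻ p, absMap Q μD ΦD (F + G) p ^ 2 ∂targetMeasure
        ≤ ∫⁻ p, (2 * absMap Q μD ΦD F p ^ 2 + 2 * absMap Q μD ΦD G p ^ 2) ∂targetMeasure := by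
          refine lintegral_mono_ae ?_
          filter_upwards [absMap_add_le hΦD Q G hF.1] with p hp
          refine (pow_le_pow_left' hp 2).trans ?_
          have := ENNReal.rpow_add_le_mul_rpow_add_rpow (absMap Q μD ΦD F p) (absMap Q μD ΦD G p)
            one_le_two
          norm_num at this
          rwa [mul_add] at this
      _ < ⊤ := by
          rw [lintegral_add_left' (hF2.const_mul 2), lintegral_const_mul' _ _ (by simp),
            lintegral_const_mul' _ _ (by simp)]
          exact ENNReal.add_lt_top.2 ⟨ENNReal.mul_lt_top (by simp) hF.2,
            ENNReal.mul_lt_top (by simp) hG.2⟩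
  smul_mem' := by
    intro k F hF
    rw [mem_osDomain_iff hΦ hΦD] at hF ⊢
    refine ⟨?_, ?_⟩
    · obtain ⟨H, hH, rfl⟩ := measurable_fieldSigma_disc_iff.1 hF.1
      exact measurable_fieldSigma_disc_iff.2 ⟨k • H, hH.const_smul k, rfl⟩
    have : ∀ p, absMap Q μD ΦD (k • F) p = ‖k‖ₑ * absMap Q μD ΦD F p := fun p => by
      simp_rw [absMap, Pi.smul_apply, smul_eq_mul, enorm_mul]
      rw [lintegral_const_mul' _ _ enorm_ne_top]
      ring
    simp_rw [this, mul_pow]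
    rw [lintegral_const_mul' _ _ (by simp)]
    exact ENNReal.mul_lt_top (by simp) hF.2

lemma ae_integrable_of_mem (hΦ : IsFreeField μ Φ) (hΦD : IsDirichletField μD ΦD) {Q : ℝ}
    {F : Config → ℂ} (hF : F ∈ osDomain Q μ Φ) :
    ∀ᵐ p ∂targetMeasure, Integrable (fun x => F (discField p (ΦD x))) μD := by
  rw [mem_osDomain_iff hΦ hΦD] at hF
  obtain ⟨hFm, hF2⟩ := hF
  have hW := ae_lt_top' ((aemeasurable_absMap hΦD Q hFm).pow_const 2) hF2.ne
  obtain ⟨H, hH, rfl⟩ := measurable_fieldSigma_disc_iff.1 hFm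
  filter_upwards [hW, ae_target_modesSummable] with p hp hp'
  refine ⟨?_, ?_⟩
  · simp_rw [Function.comp_apply, restrictDisc_discField hp']
    exact (hH.comp ((measurable_shift_discHalf hΦD).comp
      measurable_prodMk_left)).aestronglyMeasurable
  · rw [ENNReal.pow_lt_top_iff] at hp
    have hlt : absMap Q μD ΦD (H ∘ restrictDisc) p < ⊤ := by simpa using hp
    rw [absMap] at hlt
    refine ENNReal.lt_top_of_mul_ne_top_right hlt.ne ?_
    simpa using Real.exp_pos _

lemma memLp_UMap (hΦ : IsFreeField μ Φ) (hΦD : IsDirichletField μD ΦD) {Q : ℝ}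
    {F : Config → ℂ} (hF : F ∈ osDomain Q μ Φ) : MemLp (UMap Q μD ΦD F) 2 targetMeasure := by
  rw [mem_osDomain_iff hΦ hΦD] at hF
  refine ⟨aestronglyMeasurable_UMap hΦD Q hF.1, ?_⟩
  rw [eLpNorm_lt_top_iff_lintegral_rpow_enorm_lt_top two_ne_zero ENNReal.ofNat_ne_top]
  refine lt_of_le_of_lt (lintegral_mono fun p => ?_) hF.2
  simp only [ENNReal.toReal_ofNat, ENNReal.rpow_ofNat]
  exact pow_le_pow_left' (enorm_UMap_le Q F p) 2

/-- The map `U` on the domain of the form, with values in `L²`. -/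
def UMapLp (hΦ : IsFreeField μ Φ) (hΦD : IsDirichletField μD ΦD) (Q : ℝ) :
    osSubmodule hΦ hΦD Q →ₗ[ℂ] Lp ℂ 2 targetMeasure where
  toFun F := (memLp_UMap hΦ hΦD F.2).toLp
  map_add' F G := by
    rw [← MemLp.toLp_add, MemLp.toLp_eq_toLp_iff]
    filter_upwards [ae_integrable_of_mem hΦ hΦD F.2, ae_integrable_of_mem hΦ hΦD G.2]
      with p hF hG
    simp only [UMap, Submodule.coe_add, Pi.add_apply]
    rw [integral_add hF hG, mul_add]
  map_smul' k F := by
    rw [RingHom.id_apply, ← MemLp.toLp_const_smul, MemLp.toLp_eq_toLp_iff]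
    refine ae_of_all _ fun p => ?_
    simp only [UMap, Submodule.coe_smul, Pi.smul_apply, smul_eq_mul]
    rw [integral_const_mul]
    ring

lemma inner_UMapLp (hΦ : IsFreeField μ Φ) (hΦD : IsDirichletField μD ΦD) (Q : ℝ)
    (F G : osSubmodule hΦ hΦD Q) :
    inner ℂ (UMapLp hΦ hΦD Q F) (UMapLp hΦ hΦD Q G) = osForm Q μ Φ F G := by
  rw [osForm_eq hΦ hΦD Q F.2.1 G.2.1 (freeIntegrable_of_mem hΦ hΦD F.2 G.2), L2.inner_def]
  refine integral_congr_ae ?_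
  filter_upwards [(memLp_UMap hΦ hΦD F.2).coeFn_toLp, (memLp_UMap hΦ hΦD G.2).coeFn_toLp]
    with p hF hG
  rw [UMapLp, LinearMap.coe_mk, AddHom.coe_mk, hF, hG, RCLike.inner_apply, mul_comm]

end Operators

/-! ### Hilbert space completions -/

section Completion

variable {D : Submodule ℂ (Config → ℂ)} {E : Type*} [NormedAddCommGroup E] [InnerProductSpace ℂ E]

/-- The pull-back of an inner product under a linear map. -/
@[reducible]
def pullbackCore (T : D →ₗ[ℂ] E) : PreInnerProductSpace.Core ℂ D where
  inner F G := inner ℂ (T F) (T G)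
  conj_inner_symm F G := inner_conj_symm _ _
  re_inner_nonneg F := inner_self_nonneg
  add_left F G H := by rw [map_add, inner_add_left]
  smul_left F G k := by rw [map_smul, inner_smul_left]

/-- A linear map with dense range extends to a unitary map from the completion of its domain, in
the pulled back inner product. -/
lemma exists_unitary_of_denseRange [CompleteSpace E] (T : D →ₗ[ℂ] E) (hT : DenseRange T) :
    ∃ U : HilbertCompletion (pullbackCore T) ≃ₗᵢ[ℂ] E,
      ∀ F : D, U (toHilbert (pullbackCore T) F) = T F := by
  let e₁ : PreHilbert (pullbackCore T) →ₗ[ℂ] HilbertCompletion (pullbackCore T) :=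
    { toFun := fun F => ((SeparationQuotient.mk F : SeparationQuotient _) : HilbertCompletion _)
      map_add' := fun F G => by
        rw [SeparationQuotient.mk_add, UniformSpace.Completion.coe_add]
      map_smul' := fun k F => by
        rw [SeparationQuotient.mk_smul, UniformSpace.Completion.coe_smul, RingHom.id_apply] }
  let e₂ : PreHilbert (pullbackCore T) →ₗ[ℂ] E :=
    { toFun := fun F => T (show D from F)
      map_add' := fun F G => T.map_add _ _
      map_smul' := fun k F => T.map_smul _ _ }
  have hd₁ : DenseRange e₁ :=
    UniformSpace.Completion.denseRange_coe.comp SeparationQuotient.surjective_mk.denseRange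
      (UniformSpace.Completion.continuous_coe _)
  have hnorm : ∀ F, ‖e₂ (LinearEquiv.refl ℂ _ F)‖ = ‖e₁ F‖ := fun F => by
    have h1 : ‖e₁ F‖ = ‖F‖ := (UniformSpace.Completion.norm_coe _).trans (by rfl)
    have h2 : ‖F‖ = Real.sqrt (RCLike.re (inner ℂ (T (show D from F)) (T (show D from F)))) := rfl
    rw [h1, h2, ← norm_eq_sqrt_re_inner]
    rfl
  exact ⟨(LinearEquiv.refl ℂ _).extendOfIsometry e₁ e₂ hd₁ hT hnorm, fun F =>
    LinearEquiv.extendOfIsometry_eq _ e₁ e₂ hd₁ hT hnorm (show PreHilbert _ from F)⟩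

end Completion

/-! ### Rotation invariant functions -/

/-- Distinct Fourier modes are orthogonal with respect to a rotation invariant weight. -/
lemma integral_pow_mul_conj_pow_eq_zero {u : ℂ → ℝ} (hu : ∀ z w : ℂ, ‖z‖ = ‖w‖ → u z = u w)
    {m n : ℕ} (hmn : m ≠ n) : ∫ z, z ^ m * conj z ^ n * (u z : ℂ) = 0 := by
  -- a rotation under which the integrand changes its sign
  let t : ℝ := Real.pi / ((m : ℝ) - n)
  have hne : (m : ℝ) - n ≠ 0 := sub_ne_zero.2 (by exact_mod_cast hmn)
  have hsign : ((Circle.exp t : Circle) : ℂ) ^ m * conj ((Circle.exp t : Circle) : ℂ) ^ n = -1 := by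
    rw [← Circle.coe_inv_eq_conj, ← Circle.exp_neg, Circle.coe_exp, Circle.coe_exp,
      ← Complex.exp_nat_mul, ← Complex.exp_nat_mul, ← Complex.exp_add, ← Complex.exp_pi_mul_I]
    congr 1
    have : (t : ℂ) * ((m : ℂ) - n) = Real.pi := by
      rw [← Complex.ofReal_natCast, ← Complex.ofReal_natCast, ← Complex.ofReal_sub,
        ← Complex.ofReal_mul]
      congr 1
      exact div_mul_cancel₀ _ hne
    rw [← this]
    push_cast
    ring
  have h := (rotation (Circle.exp t)).measurePreserving.integral_comp'
    (f := (rotation (Circle.exp t)).toHomeomorph.toMeasurableEquiv)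
    fun z : ℂ => z ^ m * conj z ^ n * (u z : ℂ)
  have h2 : ∫ z, z ^ m * conj z ^ n * (u z : ℂ) = ∫ z, -(z ^ m * conj z ^ n * (u z : ℂ)) := by
    rw [← h]
    refine integral_congr_ae (ae_of_all _ fun z => ?_)
    show (((Circle.exp t : Circle) : ℂ) * z) ^ m * conj (((Circle.exp t : Circle) : ℂ) * z) ^ n
      * (u (((Circle.exp t : Circle) : ℂ) * z) : ℂ) = _
    rw [hu (((Circle.exp t : Circle) : ℂ) * z) z (by simp), map_mul, mul_pow, mul_pow]
    linear_combination (z ^ m * conj z ^ n * (u z : ℂ)) * hsign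
  rw [integral_neg] at h2
  exact self_eq_neg.1 h2

/-- A smooth rotation invariant bump function supported in the disc of radius one half. -/
def radialBump (z : ℂ) : ℝ :=
  (⟨1 / 8, 1 / 4, by norm_num, by norm_num⟩ : ContDiffBump (0 : ℝ)) (Complex.normSq z)

lemma contDiff_radialBump : ContDiff ℝ ∞ radialBump := by
  have h : ContDiff ℝ ∞ fun z : ℂ => Complex.normSq z := by
    simp_rw [Complex.normSq_eq_norm_sq]
    exact contDiff_norm_sq ℝ
  exact (ContDiffBump.contDiff _).comp h

lemma radialBump_nonneg (z : ℂ) : 0 ≤ radialBump z := ContDiffBump.nonneg _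

lemma radialBump_congr (z w : ℂ) (h : ‖z‖ = ‖w‖) : radialBump z = radialBump w := by
  rw [radialBump, radialBump, Complex.normSq_eq_norm_sq, Complex.normSq_eq_norm_sq, h]

lemma radialBump_eq_one {z : ℂ} (hz : ‖z‖ < 1 / 4) : radialBump z = 1 := by
  refine ContDiffBump.one_of_mem_closedBall _ ?_
  rw [mem_closedBall_zero_iff, Complex.normSq_eq_norm_sq, Real.norm_of_nonneg (by positivity)]
  nlinarith [norm_nonneg z]

lemma norm_lt_of_radialBump_ne_zero {z : ℂ} (hz : radialBump z ≠ 0) : ‖z‖ < 1 / 2 := by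
  by_contra h
  refine hz (ContDiffBump.zero_of_le_dist _ ?_)
  rw [dist_zero_right, Complex.normSq_eq_norm_sq, Real.norm_of_nonneg (by positivity)]
  show (1 / 4 : ℝ) ≤ _
  nlinarith [not_lt.1 h]

lemma hasCompactSupport_radialBump : HasCompactSupport radialBump :=
  HasCompactSupport.intro (isCompact_closedBall (0 : ℂ) (1 / 2)) fun z hz => by
    by_contra h
    exact hz (by simpa using (norm_lt_of_radialBump_ne_zero h).le)

/-- The integral `∫ |z|²ⁿ χ(z) d²z` against the radial bump. -/
def bumpMoment (n : ℕ) : ℝ := ∫ z, Complex.normSq z ^ n * radialBump z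

lemma continuous_normSq_pow_mul_bump (n : ℕ) :
    Continuous fun z => Complex.normSq z ^ n * radialBump z :=
  (Complex.continuous_normSq.pow n).mul contDiff_radialBump.continuous

lemma bumpMoment_pos (n : ℕ) : 0 < bumpMoment n := by
  refine (continuous_normSq_pow_mul_bump n).integral_pos_of_hasCompactSupport_nonneg_nonzero
    hasCompactSupport_radialBump.mul_left
    (fun z => mul_nonneg (pow_nonneg (Complex.normSq_nonneg _) _) (radialBump_nonneg z))
    (x := (1 / 8 : ℂ)) ?_
  rw [radialBump_eq_one (by norm_num)]
  simp

/-- The density `χ(z) Re (k̄ zⁿ)`, whose only non-vanishing moment is the `n`-th one. -/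
def fourierDensity (n : ℕ) (k : ℂ) : DiscDensity :=
  ⟨SphereDensity.ofCompactSupport (fun z => radialBump z * (conj k * z ^ n).re)
    (contDiff_radialBump.mul (Complex.reCLM.contDiff.comp
      (contDiff_const.mul (contDiff_id.pow n))))
    hasCompactSupport_radialBump.mul_right, by
    refine (closure_minimal (t := Metric.closedBall (0 : ℂ) (1 / 2)) (fun z hz => ?_)
      Metric.isClosed_closedBall).trans (Metric.closedBall_subset_ball (by norm_num))
    simpa using (norm_lt_of_radialBump_ne_zero (left_ne_zero_of_mul hz)).le⟩

lemma integral_pow_mul_fourierDensity (m n : ℕ) (k : ℂ) (hmn : 0 < m + n) :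
    ∫ z, z ^ m * ((fourierDensity n k).1.toFun z : ℂ)
      = if m = n then k / 2 * bumpMoment n else 0 := by
  have hi : ∀ a b : ℕ, Integrable fun z : ℂ => z ^ a * conj z ^ b * (radialBump z : ℂ) :=
    fun a b => by
      refine Continuous.integrable_of_hasCompactSupport ?_
        ((hasCompactSupport_radialBump.comp_left (g := fun x : ℝ => (x : ℂ)) (by simp)).mul_left)
      have := contDiff_radialBump.continuous
      fun_prop
  have hsplit : ∀ z : ℂ, z ^ m * ((fourierDensity n k).1.toFun z : ℂ)
      = conj k / 2 * (z ^ (m + n) * conj z ^ 0 * (radialBump z : ℂ))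
        + k / 2 * (z ^ m * conj z ^ n * (radialBump z : ℂ)) := fun z => by
    have hre : ((conj k * z ^ n).re : ℂ) = (conj k * z ^ n + k * conj z ^ n) / 2 := by
      rw [Complex.re_eq_add_conj, map_mul, Complex.conj_conj, map_pow]
    show z ^ m * ((radialBump z * (conj k * z ^ n).re : ℝ) : ℂ) = _
    rw [Complex.ofReal_mul, hre]
    ring
  simp_rw [hsplit]
  rw [integral_add ((hi _ _).const_mul _) ((hi _ _).const_mul _), integral_const_mul,
    integral_const_mul, integral_pow_mul_conj_pow_eq_zero radialBump_congr hmn.ne', mul_zero,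
    zero_add]
  split_ifs with h
  · subst h
    congr 1
    rw [bumpMoment, ← integral_complex_ofReal]
    refine integral_congr_ae (ae_of_all _ fun z => ?_)
    simp only [Complex.ofReal_mul, Complex.ofReal_pow, ← Complex.mul_conj, mul_pow]
  · rw [integral_pow_mul_conj_pow_eq_zero radialBump_congr h, mul_zero]

lemma moment_fourierDensity (n : ℕ) (k : ℂ) (m : ℕ+) :
    moment (fourierDensity n k).1 m = if (m : ℕ) = n then k / 2 * bumpMoment n else 0 :=
  integral_pow_mul_fourierDensity m n k (Nat.add_pos_left m.pos _)

lemma mass_fourierDensity {n : ℕ} (hn : 0 < n) (k : ℂ) : mass (fourierDensity n k).1 = 0 := by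
  have h := integral_pow_mul_fourierDensity 0 n k (by omega)
  rw [if_neg hn.ne] at h
  simp_rw [pow_zero, one_mul] at h
  rw [integral_complex_ofReal] at h
  exact_mod_cast h

lemma mass_fourierDensity_zero (k : ℝ) : mass (fourierDensity 0 k).1 = k * bumpMoment 0 := by
  rw [mass, bumpMoment, ← integral_const_mul]
  refine integral_congr_ae (ae_of_all _ fun z => ?_)
  show radialBump z * (conj (k : ℂ) * z ^ 0).re = _
  simp [mul_comm]

/-! ### Coordinates on the space of boundary values -/

/-- The indices of the real coordinates `c`, `αₙ`, `βₙ`. -/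
abbrev CoordIndex : Type := Option (ℕ+ × Bool)

/-- The real coordinates `c`, `αₙ`, `βₙ` of a boundary value. -/
def coord (p : ℝ × CircleModes) : CoordIndex → ℝ
  | none => p.1
  | some (n, false) => (p.2 n).1
  | some (n, true) => (p.2 n).2

/-- The boundary value with given coordinates. -/
def ofCoord (y : CoordIndex → ℝ) : ℝ × CircleModes :=
  (y none, fun n => (y (some (n, false)), y (some (n, true))))

lemma ofCoord_coord (p : ℝ × CircleModes) : ofCoord (coord p) = p := rfl

lemma measurable_coord : Measurable coord := by
  refine measurable_pi_iff.2 ?_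
  rintro (_ | ⟨n, _ | _⟩) <;> simp only [coord] <;> fun_prop

lemma measurable_ofCoord : Measurable ofCoord := by
  unfold ofCoord
  fun_prop

/-- Densities in the disc that measure the coordinates of the boundary value. -/
def coordDensity : CoordIndex → DiscDensity
  | none => fourierDensity 0 ((bumpMoment 0)⁻¹ : ℝ)
  | some (n, false) => fourierDensity n (2 * Real.sqrt (n : ℕ) / bumpMoment n)
  | some (n, true) => fourierDensity n (2 * Real.sqrt (n : ℕ) / bumpMoment n * Complex.I)

lemma modeSum_single (a : CircleModes) (m : ℕ+ → ℂ) (n : ℕ+) (h : ∀ l, l ≠ n → m l = 0) :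
    modeSum a m = modePair a m n :=
  tsum_eq_single n fun l hl => by rw [modePair, h l hl, map_zero, mul_zero, Complex.zero_re]

lemma coord_eq (p : ℝ × CircleModes) (t : CoordIndex) :
    p.1 * mass (coordDensity t).1 + modeSum p.2 (moment (coordDensity t).1) = coord p t := by
  have hs : ∀ n : ℕ+, Real.sqrt (n : ℕ) ≠ 0 := fun n =>
    (Real.sqrt_pos.2 (by exact_mod_cast n.pos)).ne'
  have hb : ∀ n : ℕ, (bumpMoment n : ℂ) ≠ 0 := fun n => by
    exact_mod_cast (bumpMoment_pos n).ne'
  rcases t with _ | ⟨n, _ | _⟩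
  · have hm : ∀ l, moment (coordDensity none).1 l = 0 := fun l => by
      rw [coordDensity, moment_fourierDensity, if_neg l.ne_zero]
    have h0 : modeSum p.2 (moment (coordDensity none).1) = 0 := by
      rw [modeSum_single _ _ 1 fun l _ => hm l, modePair, hm]
      simp
    rw [h0, coordDensity, mass_fourierDensity_zero, inv_mul_cancel₀ (bumpMoment_pos 0).ne', coord]
    ring
  · rw [coordDensity, mass_fourierDensity n.pos, modeSum_single _ _ n, modePair_eq,
      moment_fourierDensity, if_pos rfl]
    · have : 2 * (Real.sqrt (n : ℕ) : ℂ) / bumpMoment n / 2 * bumpMoment n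
          = (Real.sqrt (n : ℕ) : ℝ) := by
        field_simp [hb n]
      rw [this, Complex.ofReal_re, Complex.ofReal_im, coord]
      field_simp [hs n]
      ring
    · intro l hl
      rw [moment_fourierDensity, if_neg (by exact_mod_cast hl)]
  · rw [coordDensity, mass_fourierDensity n.pos, modeSum_single _ _ n, modePair_eq,
      moment_fourierDensity, if_pos rfl]
    · have : 2 * (Real.sqrt (n : ℕ) : ℂ) / bumpMoment n * Complex.I / 2 * bumpMoment n
          = (Real.sqrt (n : ℕ) : ℝ) * Complex.I := by
        field_simp [hb n]
      rw [this, coord]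
      simp only [Complex.mul_re, Complex.mul_im, Complex.ofReal_re, Complex.ofReal_im,
        Complex.I_re, Complex.I_im]
      field_simp [hs n]
      ring
    · intro l hl
      rw [moment_fourierDensity, if_neg (by exact_mod_cast hl)]

/-! ### Completeness of damped characters -/

/-- The real case of `ae_eq_zero_of_charFun`: the positive and negative parts of `h` define finite
measures with equal characteristic functions. -/
lemma ae_eq_zero_of_charFun_real {X T : Type*} [MeasurableSpace X] {ν : Measure X}
    {e : X → T → ℝ} {r : (T → ℝ) → X} (he : Measurable e) (hr : Measurable r)
    (hre : ∀ x, r (e x) = x) {h : X → ℝ} (hh : Integrable h ν)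
    (h0 : ∀ (I : Finset T) (s : T → ℝ),
      ∫ x, (h x : ℂ) * Complex.exp (Complex.I * ((∑ t ∈ I, s t * e x t : ℝ) : ℂ)) ∂ν = 0) :
    h =ᵐ[ν] 0 := by
  have hfin : ∀ {g : X → ℝ}, Integrable g ν →
      IsFiniteMeasure (ν.withDensity fun x => ENNReal.ofReal (g x)) := fun hg =>
    isFiniteMeasure_withDensity_ofReal hg.2
  have := hfin hh
  have := hfin hh.neg
  have hchar : ∀ {g : X → ℝ}, Integrable g ν → ∀ (I : Finset T) (s : T → ℝ),
      ∫ y, Complex.exp (Complex.I * ((∑ t ∈ I, s t * y t : ℝ) : ℂ))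
        ∂((ν.withDensity fun x => ENNReal.ofReal (g x)).map e)
      = ∫ x, ((max (g x) 0 : ℝ) : ℂ)
          * Complex.exp (Complex.I * ((∑ t ∈ I, s t * e x t : ℝ) : ℂ)) ∂ν := by
    intro g hg I s
    have hm : Measurable fun y : T → ℝ =>
        Complex.exp (Complex.I * ((∑ t ∈ I, s t * y t : ℝ) : ℂ)) := by fun_prop
    rw [integral_map he.aemeasurable hm.aestronglyMeasurable,
      integral_withDensity_eq_integral_toReal_smul₀ hg.aemeasurable.ennreal_ofReal
        (ae_of_all _ fun x => ENNReal.ofReal_lt_top)]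
    simp_rw [ENNReal.toReal_ofReal', Complex.real_smul]
  have hint : ∀ {g : X → ℝ}, Integrable g ν → ∀ (I : Finset T) (s : T → ℝ),
      Integrable (fun x => ((max (g x) 0 : ℝ) : ℂ)
          * Complex.exp (Complex.I * ((∑ t ∈ I, s t * e x t : ℝ) : ℂ))) ν := by
    intro g hg I s
    refine (hg.pos_part.ofReal (𝕜 := ℂ)).mul_bdd (c := 1) ?_ (ae_of_all _ fun x => ?_)
    · have : Measurable fun x => ∑ t ∈ I, s t * e x t :=
        Finset.measurable_sum I fun t _ => ((measurable_pi_iff.1 he) t).const_mul _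
      exact (Complex.measurable_exp.comp
        ((Complex.measurable_ofReal.comp this).const_mul _)).aestronglyMeasurable
    · rw [mul_comm Complex.I, Complex.norm_exp_ofReal_mul_I]
  have hmap : (ν.withDensity fun x => ENNReal.ofReal (h x)).map e
      = (ν.withDensity fun x => ENNReal.ofReal ((-h) x)).map e := by
    refine measure_ext_of_charFun fun I s => ?_
    rw [hchar hh, hchar hh.neg, ← sub_eq_zero, ← integral_sub (hint hh I s) (hint hh.neg I s),
      ← h0 I s]
    refine integral_congr_ae (ae_of_all _ fun x => ?_)
    simp only [Pi.neg_apply]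
    rw [← sub_mul, ← Complex.ofReal_sub, max_zero_sub_eq_self]
  have hid : ∀ κ : Measure X, (κ.map e).map r = κ := fun κ => by
    rw [Measure.map_map hr he, show r ∘ e = id from funext hre, Measure.map_id]
  have heq := congrArg (Measure.map r) hmap
  rw [hid, hid, withDensity_eq_iff hh.aemeasurable.ennreal_ofReal
    hh.neg.aemeasurable.ennreal_ofReal hh.lintegral_lt_top.ne] at heq
  filter_upwards [heq] with x hx
  have hx' : max (h x) 0 = max (-h x) 0 := by
    simpa [ENNReal.toReal_ofReal'] using congrArg ENNReal.toReal hx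
  rcases le_total (h x) 0 with hle | hle
  · rw [max_eq_right hle, max_eq_left (by linarith)] at hx'
    simp only [Pi.zero_apply]
    linarith
  · rw [max_eq_left hle, max_eq_right (by linarith)] at hx'
    exact hx'

/-- An integrable function whose integrals against all characters of a complete system of
coordinates vanish is zero. -/
lemma ae_eq_zero_of_charFun {X T : Type*} [MeasurableSpace X] {ν : Measure X}
    {e : X → T → ℝ} {r : (T → ℝ) → X} (he : Measurable e) (hr : Measurable r)
    (hre : ∀ x, r (e x) = x) {g : X → ℂ} (hg : Integrable g ν)
    (h0 : ∀ (I : Finset T) (s : T → ℝ),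
      ∫ x, g x * Complex.exp (Complex.I * ((∑ t ∈ I, s t * e x t : ℝ) : ℂ)) ∂ν = 0) :
    g =ᵐ[ν] 0 := by
  have hmul : ∀ {k : X → ℂ}, Integrable k ν → ∀ (I : Finset T) (s : T → ℝ),
      Integrable (fun x => k x
        * Complex.exp (Complex.I * ((∑ t ∈ I, s t * e x t : ℝ) : ℂ))) ν := by
    intro k hk I s
    refine hk.mul_bdd (c := 1) ?_ (ae_of_all _ fun x => ?_)
    · have : Measurable fun x => ∑ t ∈ I, s t * e x t :=
        Finset.measurable_sum I fun t _ => ((measurable_pi_iff.1 he) t).const_mul _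
      exact (Complex.measurable_exp.comp
        ((Complex.measurable_ofReal.comp this).const_mul _)).aestronglyMeasurable
    · rw [mul_comm Complex.I, Complex.norm_exp_ofReal_mul_I]
  have hgc : Integrable (fun x => conj (g x)) ν := Complex.conjCLE.integrable_comp_iff.2 hg
  -- the conjugate of `g` has the same property, by changing the signs of the frequencies
  have h0c : ∀ (I : Finset T) (s : T → ℝ),
      ∫ x, conj (g x) * Complex.exp (Complex.I * ((∑ t ∈ I, s t * e x t : ℝ) : ℂ)) ∂ν = 0 := by
    intro I s
    have h := congrArg conj (h0 I fun t => -s t)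
    rw [← integral_conj, map_zero] at h
    rw [← h]
    refine integral_congr_ae (ae_of_all _ fun x => ?_)
    simp only [map_mul, ← Complex.exp_conj, neg_mul, Finset.sum_neg_distrib, Complex.ofReal_neg,
      mul_neg, map_neg, Complex.conj_I, Complex.conj_ofReal, neg_neg]
  have hre0 : (fun x => (g x).re) =ᵐ[ν] 0 := by
    refine ae_eq_zero_of_charFun_real he hr hre hg.re fun I s => ?_
    have : ∀ x, ((g x).re : ℂ) * Complex.exp (Complex.I * ((∑ t ∈ I, s t * e x t : ℝ) : ℂ))
        = (1 / 2 : ℂ) * (g x * Complex.exp (Complex.I * ((∑ t ∈ I, s t * e x t : ℝ) : ℂ))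
          + conj (g x) * Complex.exp (Complex.I * ((∑ t ∈ I, s t * e x t : ℝ) : ℂ))) := fun x => by
      rw [Complex.re_eq_add_conj]
      ring
    simp_rw [this]
    rw [integral_const_mul, integral_add (hmul hg I s) (hmul hgc I s), h0, h0c]
    simp
  have him0 : (fun x => (g x).im) =ᵐ[ν] 0 := by
    refine ae_eq_zero_of_charFun_real he hr hre hg.im fun I s => ?_
    have : ∀ x, ((g x).im : ℂ) * Complex.exp (Complex.I * ((∑ t ∈ I, s t * e x t : ℝ) : ℂ))
        = (1 / (2 * Complex.I) : ℂ) *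
          (g x * Complex.exp (Complex.I * ((∑ t ∈ I, s t * e x t : ℝ) : ℂ))
          - conj (g x) * Complex.exp (Complex.I * ((∑ t ∈ I, s t * e x t : ℝ) : ℂ))) := fun x => by
      rw [Complex.im_eq_sub_conj]
      ring
    simp_rw [this]
    rw [integral_const_mul, integral_sub (hmul hg I s) (hmul hgc I s), h0, h0c]
    simp
  filter_upwards [hre0, him0] with x h1 h2
  exact Complex.ext h1 h2

/-! ### Gaussian damping -/

/-- Fourier representation of the Gaussian. -/
lemma cexp_neg_sq_eq_integral (x : ℝ) :
    Complex.exp (-(x : ℂ) ^ 2 / 2)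
      = ∫ t : ℝ, Complex.exp (Complex.I * x * (t : ℂ)) ∂gaussianReal 0 1 := by
  rw [integral_cexp_mul (μ := gaussianReal 0 1) (Y := fun u => u) (v := 1) Measure.map_id,
    mul_pow, Complex.I_sq]
  simp

/-- The expectation of a damped character of a Gaussian pair `(u, v)` of covariance
`((S, ρ), (ρ, V))`. The frequency `ρ` of `c + u` is the one for which the result has no phase. -/
lemma exists_integral_damped {Ω : Type*} [MeasurableSpace Ω] {μ : Measure Ω}
    [IsProbabilityMeasure μ] {u v : Ω → ℝ} (hu : Measurable u) (hv : Measurable v) {S ρ V : ℝ}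
    (hS : 0 ≤ S)
    (h : ∀ x : ℝ, ∫ y, Complex.exp (Complex.I * ((x * u y + v y : ℝ) : ℂ)) ∂μ
      = Complex.exp (-((x ^ 2 * S + 2 * x * ρ + V : ℝ) : ℂ) / 2)) :
    ∃ K : ℂ, K ≠ 0 ∧ ∀ c : ℝ,
      ∫ y, Complex.exp (-((c + u y : ℝ) : ℂ) ^ 2 / 2
          + Complex.I * ((ρ * (c + u y) + v y : ℝ) : ℂ)) ∂μ
        = K * (Real.exp (-c ^ 2 / (2 * (1 + S))) : ℂ) := by
  set b : ℂ := -((1 + S : ℝ) : ℂ) / 2 with hb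
  have hS1 : (0 : ℝ) < 1 + S := by linarith
  have hSc : (1 + S : ℂ) ≠ 0 := by exact_mod_cast hS1.ne'
  have hbre : b.re < 0 := by
    rw [hb, ← Complex.ofReal_neg, ← Complex.ofReal_ofNat, ← Complex.ofReal_div, Complex.ofReal_re]
    linarith
  have hpi : ((Real.sqrt (2 * Real.pi))⁻¹ : ℂ) ≠ 0 := by
    have : Real.sqrt (2 * Real.pi) ≠ 0 := (Real.sqrt_pos.2 (by positivity)).ne'
    exact inv_ne_zero (by exact_mod_cast this)
  refine ⟨((Real.sqrt (2 * Real.pi))⁻¹ : ℂ) * (((Real.pi : ℂ) / -b) ^ (1 / 2 : ℂ)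
    * Complex.exp (-((ρ ^ 2 + V : ℝ) : ℂ) / 2)), ?_, fun c => ?_⟩
  · refine mul_ne_zero hpi (mul_ne_zero ?_ (Complex.exp_ne_zero _))
    have hbase : (Real.pi : ℂ) / -b ≠ 0 := by
      refine div_ne_zero (by exact_mod_cast Real.pi_ne_zero) (neg_ne_zero.2 fun hb0 => ?_)
      rw [hb0] at hbre
      simp at hbre
    rw [Complex.cpow_def_of_ne_zero hbase]
    exact Complex.exp_ne_zero _
  · have hrep : ∀ y, Complex.exp (-((c + u y : ℝ) : ℂ) ^ 2 / 2
          + Complex.I * ((ρ * (c + u y) + v y : ℝ) : ℂ))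
        = ∫ t : ℝ, Complex.exp (Complex.I * (((t + ρ) * (c + u y) + v y : ℝ) : ℂ))
            ∂gaussianReal 0 1 := fun y => by
      rw [Complex.exp_add, cexp_neg_sq_eq_integral, ← integral_mul_const]
      refine integral_congr_ae (ae_of_all _ fun t => ?_)
      simp only
      rw [← Complex.exp_add]
      congr 1
      push_cast
      ring
    have hint : Integrable (fun q : Ω × ℝ =>
        Complex.exp (Complex.I * (((q.2 + ρ) * (c + u q.1) + v q.1 : ℝ) : ℂ)))
        (μ.prod (gaussianReal 0 1)) := by
      refine (integrable_const (1 : ℝ)).mono' ?_ (ae_of_all _ fun q => ?_)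
      · exact (by fun_prop : Measurable _).aestronglyMeasurable
      · rw [mul_comm Complex.I, Complex.norm_exp_ofReal_mul_I]
    simp_rw [hrep]
    rw [integral_integral_swap (f := fun y t =>
      Complex.exp (Complex.I * (((t + ρ) * (c + u y) + v y : ℝ) : ℂ))) hint]
    have hin : ∀ t : ℝ, ∫ y, Complex.exp (Complex.I * (((t + ρ) * (c + u y) + v y : ℝ) : ℂ)) ∂μ
        = Complex.exp (Complex.I * (((t + ρ) * c : ℝ) : ℂ)
          - (((t + ρ) ^ 2 * S + 2 * (t + ρ) * ρ + V : ℝ) : ℂ) / 2) := fun t => by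
      rw [sub_eq_add_neg, Complex.exp_add, ← neg_div, ← h (t + ρ), ← integral_const_mul]
      refine integral_congr_ae (ae_of_all _ fun y => ?_)
      simp only
      rw [← Complex.exp_add]
      congr 1
      push_cast
      ring
    simp_rw [hin]
    rw [integral_gaussianReal_eq_integral_smul one_ne_zero]
    have hdens : ∀ t : ℝ, gaussianPDFReal 0 1 t •
        Complex.exp (Complex.I * (((t + ρ) * c : ℝ) : ℂ)
          - (((t + ρ) ^ 2 * S + 2 * (t + ρ) * ρ + V : ℝ) : ℂ) / 2)
        = ((Real.sqrt (2 * Real.pi))⁻¹ : ℂ) * Complex.exp (b * (t : ℂ) ^ 2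
          + (Complex.I * c - ρ * (1 + S)) * (t : ℂ)
          + (Complex.I * ρ * c - (ρ ^ 2 * S + 2 * ρ ^ 2 + V) / 2)) := fun t => by
      rw [gaussianPDFReal_def, Complex.real_smul]
      simp only [NNReal.coe_one, mul_one, sub_zero]
      rw [Complex.ofReal_mul, Complex.ofReal_exp, mul_assoc, ← Complex.exp_add]
      congr 2
      · push_cast
        rfl
      · rw [hb]
        push_cast
        ring
    simp_rw [hdens]
    rw [integral_const_mul, integral_cexp_quadratic hbre, mul_assoc, mul_assoc, mul_assoc,
      Complex.ofReal_exp,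
      ← Complex.exp_add]
    congr 3
    rw [hb]
    push_cast
    field_simp
    ring_nf
    rw [Complex.I_sq]
    ring

/-! ### Density of the range of `U` -/

section Density

variable {Ω Ω' : Type*} [MeasurableSpace Ω] [MeasurableSpace Ω'] {μ : Measure Ω}
  {μD : Measure Ω'} {Φ : Ω → Config} {ΦD : Ω' → Config}

lemma discField_apply {p : ℝ × CircleModes} (hp : ModesSummable p.2) (X : Config)
    (f : DiscDensity) :
    discField p X f.1 = p.1 * mass f.1 + modeSum p.2 (moment f.1) + X f.1 := by
  have h := congrFun (restrictDisc_discField hp X) f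
  simp only [restrictDisc, shift, discHalf] at h
  rw [h]
  ring

lemma discField_coordDensity {p : ℝ × CircleModes} (hp : ModesSummable p.2) (X : Config)
    (t : CoordIndex) :
    discField p X (coordDensity t).1 = coord p t + X (coordDensity t).1 := by
  rw [discField_apply hp, coord_eq]

/-- Characters of the coordinates, damped by a Gaussian function of the average of the field. The
additional frequency `r` serves to cancel a phase, see `exists_integral_damped`. -/
def dampedCharacter (I : Finset CoordIndex) (s : CoordIndex → ℝ) (r : ℝ) : Config → ℂ := fun φ =>
  Complex.exp (-(φ (coordDensity none).1 : ℂ) ^ 2 / 2 + Complex.I *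
    ((r * φ (coordDensity none).1 + ∑ t ∈ I, s t * φ (coordDensity t).1 : ℝ) : ℂ))

lemma measurable_dampedCharacter (I : Finset CoordIndex) (s : CoordIndex → ℝ) (r : ℝ) :
    Measurable[fieldSigma disc] (dampedCharacter I s r) :=
  measurable_fieldSigma_disc_iff.2
    ⟨fun v => Complex.exp (-(v (coordDensity none) : ℂ) ^ 2 / 2 + Complex.I *
      ((r * v (coordDensity none) + ∑ t ∈ I, s t * v (coordDensity t) : ℝ) : ℂ)),
      by fun_prop, rfl⟩

lemma norm_dampedCharacter (I : Finset CoordIndex) (s : CoordIndex → ℝ) (r : ℝ) (φ : Config) :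
    ‖dampedCharacter I s r φ‖ = Real.exp (-φ (coordDensity none).1 ^ 2 / 2) := by
  rw [dampedCharacter, Complex.exp_add, norm_mul, mul_comm Complex.I,
    Complex.norm_exp_ofReal_mul_I, mul_one, Complex.norm_exp]
  congr 1
  norm_cast

/-- The variance of the Dirichlet field averaged over the bump function. -/
def bumpVariance : ℝ := ∫ z in disc, ∫ w in disc,
  greenDisc z w * (coordDensity none).1.toFun z * (coordDensity none).1.toFun w

lemma bumpVariance_nonneg (hΦD : IsDirichletField μD ΦD) : 0 ≤ bumpVariance := by
  rw [bumpVariance, ← hΦD.covariance_eq]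
  exact integral_nonneg fun x => mul_self_nonneg _

/-- The Gaussian profile `exp (-Q c - c² / (2 (1 + S)))` of the images of damped characters. -/
def damping (Q : ℝ) (p : ℝ × CircleModes) : ℝ :=
  Real.exp (-Q * p.1) * Real.exp (-p.1 ^ 2 / (2 * (1 + bumpVariance)))

lemma damping_pos (Q : ℝ) (p : ℝ × CircleModes) : 0 < damping Q p := by
  unfold damping
  positivity

lemma measurable_damping (Q : ℝ) : Measurable (damping Q) := by
  unfold damping
  fun_prop

lemma integrable_damping_sq (hΦD : IsDirichletField μD ΦD) (Q : ℝ) :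
    Integrable (fun p => damping Q p ^ 2) targetMeasure := by
  have hS : 0 < 1 + bumpVariance := by linarith [bumpVariance_nonneg hΦD]
  have h : Integrable fun c : ℝ =>
      (Real.exp (-Q * c) * Real.exp (-c ^ 2 / (2 * (1 + bumpVariance)))) ^ 2 := by
    have hb : (-((1 + bumpVariance)⁻¹ : ℝ) : ℂ).re < 0 := by
      rw [← Complex.ofReal_neg, Complex.ofReal_re]
      simpa using hS
    have := (integrable_cexp_quadratic' hb ((-2 * Q : ℝ) : ℂ) 0).norm
    refine this.congr (ae_of_all _ fun c => ?_)
    simp only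
    rw [← Real.exp_add, ← Real.exp_nat_mul, Complex.norm_exp]
    congr 1
    rw [add_zero, ← Complex.ofReal_neg, ← Complex.ofReal_pow, ← Complex.ofReal_mul,
      ← Complex.ofReal_mul, ← Complex.ofReal_add, Complex.ofReal_re]
    push_cast
    field_simp
    ring
  exact h.comp_fst circleMeasure

/-- Up to a non-zero factor, `U` maps damped characters, with a suitable frequency `r`, to the
characters of the coordinates times `damping`. -/
lemma exists_integral_dampedCharacter [IsProbabilityMeasure μD] (hΦD : IsDirichletField μD ΦD)
    (Q : ℝ) (I : Finset CoordIndex) (s : CoordIndex → ℝ) :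
    ∃ (r : ℝ) (K : ℂ), K ≠ 0 ∧ ∀ p : ℝ × CircleModes, ModesSummable p.2 →
      UMap Q μD ΦD (dampedCharacter I s r) p = K * ((damping Q p : ℝ) : ℂ)
        * Complex.exp (Complex.I * ((∑ t ∈ I, s t * coord p t : ℝ) : ℂ)) := by
  set C : SphereDensity → SphereDensity → ℝ := fun f g =>
    ∫ z in disc, ∫ w in disc, greenDisc z w * f.toFun z * g.toFun w with hC
  have hsymm : ∀ f g, C f g = C g f := fun f g => by
    rw [hC]
    simp only
    rw [← hΦD.covariance_eq, ← hΦD.covariance_eq]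
    simp_rw [mul_comm]
  let d : Option CoordIndex → SphereDensity := fun o => (coordDensity (o.getD none)).1
  have hchar : ∀ x : ℝ, ∫ y, Complex.exp (Complex.I * ((x * ΦD y (coordDensity none).1
      + ∑ t ∈ I, s t * ΦD y (coordDensity t).1 : ℝ) : ℂ)) ∂μD
      = Complex.exp (-((x ^ 2 * bumpVariance
        + 2 * x * (∑ t ∈ I, s t * C (coordDensity none).1 (coordDensity t).1)
        + quadForm (fun i j => C (coordDensity i).1 (coordDensity j).1) I s : ℝ) : ℂ) / 2) := by
    intro x
    have h := hΦD.integral_cexp_sum d (Finset.insertNone I) fun o => o.elim x s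
    simp only [Finset.sum_insertNone, Option.elim_none, Option.elim_some, d, Option.getD_none,
      Option.getD_some, quadForm] at h
    rw [h]
    congr 4
    rw [Finset.sum_add_distrib]
    have h1 : ∑ t ∈ I, x * s t * C (coordDensity none).1 (coordDensity t).1
        = x * ∑ t ∈ I, s t * C (coordDensity none).1 (coordDensity t).1 := by
      rw [Finset.mul_sum]
      exact Finset.sum_congr rfl fun t _ => by ring
    have h2 : ∑ t ∈ I, s t * x * C (coordDensity t).1 (coordDensity none).1
        = x * ∑ t ∈ I, s t * C (coordDensity none).1 (coordDensity t).1 := by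
      rw [Finset.mul_sum]
      exact Finset.sum_congr rfl fun t _ => by rw [hsymm]; ring
    have h3 : bumpVariance = C (coordDensity none).1 (coordDensity none).1 := rfl
    rw [h3, quadForm]
    linear_combination h1 + h2
  obtain ⟨K, hK, h⟩ := exists_integral_damped (hΦD.measurable_eval (coordDensity none).1)
    (Finset.measurable_sum I fun t _ => (hΦD.measurable_eval (coordDensity t).1).const_mul (s t))
    (bumpVariance_nonneg hΦD) hchar
  refine ⟨∑ t ∈ I, s t * C (coordDensity none).1 (coordDensity t).1, K, hK, fun p hp => ?_⟩
  have hF : ∀ y, dampedCharacter I s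
        (∑ t ∈ I, s t * C (coordDensity none).1 (coordDensity t).1) (discField p (ΦD y))
      = Complex.exp (Complex.I * ((∑ t ∈ I, s t * coord p t : ℝ) : ℂ)) *
        Complex.exp (-((p.1 + ΦD y (coordDensity none).1 : ℝ) : ℂ) ^ 2 / 2 + Complex.I *
          (((∑ t ∈ I, s t * C (coordDensity none).1 (coordDensity t).1)
            * (p.1 + ΦD y (coordDensity none).1)
            + ∑ t ∈ I, s t * ΦD y (coordDensity t).1 : ℝ) : ℂ)) := fun y => by
    simp_rw [dampedCharacter, discField_coordDensity hp, mul_add (s _), Finset.sum_add_distrib]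
    rw [← Complex.exp_add]
    congr 1
    simp only [coord]
    push_cast
    ring
  rw [UMap]
  simp_rw [hF]
  rw [integral_const_mul, h, damping]
  push_cast
  ring

variable [IsProbabilityMeasure μ] [IsProbabilityMeasure μD]

/-- The modulus of a damped character is a Gaussian function of the field average, whose weighted
expectation is a multiple of `damping`. -/
lemma dampedCharacter_mem (hΦ : IsFreeField μ Φ) (hΦD : IsDirichletField μD ΦD) (Q : ℝ)
    (I : Finset CoordIndex) (s : CoordIndex → ℝ) (r : ℝ) :
    dampedCharacter I s r ∈ osDomain Q μ Φ := by
  rw [mem_osDomain_iff hΦ hΦD]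
  refine ⟨measurable_dampedCharacter I s r, ?_⟩
  obtain ⟨K, hK, h⟩ := exists_integral_damped (v := fun _ => 0) (ρ := 0) (V := 0)
    (hΦD.measurable_eval (coordDensity none).1) measurable_const (bumpVariance_nonneg hΦD)
    (fun x => by
      have h := hΦD.integral_cexp_sum (fun _ : Unit => (coordDensity none).1) {()} fun _ => x
      simp only [Finset.sum_singleton, quadForm] at h
      simp only [add_zero, mul_zero]
      rw [h, bumpVariance, sq])
  have hle : ∀ᵐ p ∂targetMeasure, absMap Q μD ΦD (dampedCharacter I s r) p
      ≤ ENNReal.ofReal (‖K‖ * damping Q p) := by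
    filter_upwards [ae_target_modesSummable] with p hp
    have hm : Measurable fun y => Real.exp (-(p.1 + ΦD y (coordDensity none).1) ^ 2 / 2) := by
      have := hΦD.measurable_eval (coordDensity none).1
      fun_prop
    have hi : Integrable (fun y => Real.exp (-(p.1 + ΦD y (coordDensity none).1) ^ 2 / 2)) μD := by
      refine (integrable_const (1 : ℝ)).mono' hm.aestronglyMeasurable (ae_of_all _ fun y => ?_)
      rw [Real.norm_of_nonneg (Real.exp_pos _).le, Real.exp_le_one_iff]
      nlinarith [sq_nonneg (p.1 + ΦD y (coordDensity none).1)]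
    have hn : ∀ y, ‖dampedCharacter I s r (discField p (ΦD y))‖ₑ
        = ENNReal.ofReal (Real.exp (-(p.1 + ΦD y (coordDensity none).1) ^ 2 / 2)) := fun y => by
      rw [← ofReal_norm, norm_dampedCharacter, discField_coordDensity hp]
      rfl
    have hval : ((∫ y, Real.exp (-(p.1 + ΦD y (coordDensity none).1) ^ 2 / 2) ∂μD : ℝ) : ℂ)
        = K * (Real.exp (-p.1 ^ 2 / (2 * (1 + bumpVariance))) : ℂ) := by
      rw [← h p.1, ← integral_complex_ofReal]
      refine integral_congr_ae (ae_of_all _ fun y => ?_)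
      simp only [zero_mul, add_zero, Complex.ofReal_zero, mul_zero]
      push_cast
      rfl
    rw [absMap]
    simp_rw [hn]
    rw [← ofReal_integral_eq_lintegral_ofReal hi (ae_of_all _ fun y => (Real.exp_pos _).le),
      ← ENNReal.ofReal_mul (Real.exp_pos _).le, damping, mul_left_comm]
    refine ENNReal.ofReal_le_ofReal ?_
    gcongr
    refine (le_abs_self _).trans (le_of_eq ?_)
    rw [← Real.norm_eq_abs, ← Complex.norm_real, hval, norm_mul, Complex.norm_real,
      Real.norm_of_nonneg (Real.exp_pos _).le]
  refine lt_of_le_of_lt (lintegral_mono_ae (g := fun p =>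
    ENNReal.ofReal (‖K‖ ^ 2 * damping Q p ^ 2)) ?_)
    ((integrable_damping_sq hΦD Q).const_mul _).lintegral_lt_top
  filter_upwards [hle] with p hp
  rw [← mul_pow, ENNReal.ofReal_pow (mul_nonneg (norm_nonneg _) (damping_pos Q p).le)]
  exact pow_le_pow_left' hp 2

/-- The range of `U` is dense: times `damping`, a function orthogonal to it is integrable and has
vanishing integrals against all characters. -/
lemma denseRange_UMapLp (hΦ : IsFreeField μ Φ) (hΦD : IsDirichletField μD ΦD) (Q : ℝ) :
    DenseRange (UMapLp hΦ hΦD Q) := by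
  have hbot : (LinearMap.range (UMapLp hΦ hΦD Q)).topologicalClosure = ⊤ := by
    rw [Submodule.topologicalClosure_eq_top_iff, Submodule.eq_bot_iff]
    intro ψ hψ
    rw [Submodule.mem_orthogonal] at hψ
    have hdamp : MemLp (fun p => ((damping Q p : ℝ) : ℂ)) 2 targetMeasure :=
      ((memLp_two_iff_integrable_sq (measurable_damping Q).aestronglyMeasurable).2
        (integrable_damping_sq hΦD Q)).ofReal
    have hint : Integrable (fun p => (ψ : ℝ × CircleModes → ℂ) p * ((damping Q p : ℝ) : ℂ))
        targetMeasure := (Lp.memLp ψ).integrable_mul hdamp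
    have hzero : (fun p => (ψ : ℝ × CircleModes → ℂ) p * ((damping Q p : ℝ) : ℂ))
        =ᵐ[targetMeasure] 0 := by
      refine ae_eq_zero_of_charFun measurable_coord measurable_ofCoord ofCoord_coord hint
        fun I s => ?_
      obtain ⟨r, K, hK, hU⟩ := exists_integral_dampedCharacter hΦD Q I fun t => -s t
      let F : osSubmodule hΦ hΦD Q := ⟨_, dampedCharacter_mem hΦ hΦD Q I (fun t => -s t) r⟩
      have h := hψ _ ⟨F, rfl⟩
      rw [L2.inner_def] at h
      have hcongr : ∫ p, inner ℂ ((UMapLp hΦ hΦD Q F : Lp ℂ 2 targetMeasure) p) (ψ p)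
            ∂targetMeasure
          = ∫ p, conj K * ((ψ : ℝ × CircleModes → ℂ) p * ((damping Q p : ℝ) : ℂ)
            * Complex.exp (Complex.I * ((∑ t ∈ I, s t * coord p t : ℝ) : ℂ)))
            ∂targetMeasure := by
        refine integral_congr_ae ?_
        filter_upwards [(memLp_UMap hΦ hΦD F.2).coeFn_toLp, ae_target_modesSummable] with p hp hp'
        rw [UMapLp, LinearMap.coe_mk, AddHom.coe_mk, hp, RCLike.inner_apply, hU p hp']
        simp only [map_mul, ← Complex.exp_conj, neg_mul, Finset.sum_neg_distrib,
          Complex.ofReal_neg, mul_neg, map_neg, Complex.conj_I, Complex.conj_ofReal, neg_neg]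
        ring
      rw [hcongr, integral_const_mul] at h
      exact (mul_eq_zero.1 h).resolve_left (by simpa using hK)
    refine Lp.ext ?_
    filter_upwards [hzero, Lp.coeFn_zero ℂ 2 targetMeasure] with p hp h0
    rw [h0]
    exact (mul_eq_zero.1 hp).resolve_right (by exact_mod_cast (damping_pos Q p).ne')
  exact (Submodule.dense_iff_topologicalClosure_eq_top).2 hbot

end Density

/-! ### Vertex operators -/

section Vertex

lemma Mollifier.density_apply (ρ : Mollifier) (ε : ℝ) (z w : ℂ) :
    (ρ.density ε z).toFun w = (ε ^ 2)⁻¹ * ρ.toFun ((ε⁻¹ : ℝ) • (z - w)) := rfl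

lemma Mollifier.eventually_tsupport_subset (ρ : Mollifier) {z : ℂ} (hz : z ∈ disc) :
    ∀ᶠ ε in 𝓝[>] (0 : ℝ), tsupport (ρ.density ε z).toFun ⊆ disc := by
  obtain ⟨R, hR⟩ := ρ.compact_support.isBounded.subset_closedBall (0 : ℂ)
  have hz1 : ‖z‖ < 1 := by simpa using hz
  have hlim : Tendsto (fun ε : ℝ => ‖z‖ + ε * R) (𝓝[>] 0) (𝓝 (‖z‖ + 0 * R)) :=
    tendsto_const_nhds.add ((tendsto_id.mono_left nhdsWithin_le_nhds).mul_const R)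
  filter_upwards [hlim.eventually_lt_const (by simpa using hz1), self_mem_nhdsWithin] with ε hε hε0
  have hε0' : 0 < ε := hε0
  refine (closure_minimal (t := Metric.closedBall z (ε * R)) (fun w hw => ?_)
    Metric.isClosed_closedBall).trans fun w hw => ?_
  · have h1 := hR (subset_tsupport _ (right_ne_zero_of_mul hw))
    rw [mem_closedBall_zero_iff, norm_smul, Real.norm_of_nonneg (inv_pos.2 hε0').le,
      inv_mul_le_iff₀ hε0'] at h1
    rwa [Metric.mem_closedBall, dist_comm, dist_eq_norm]
  · rw [mem_ball_zero_iff]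
    rw [Metric.mem_closedBall, dist_eq_norm] at hw
    calc ‖w‖ = ‖z + (w - z)‖ := by rw [add_sub_cancel]
      _ ≤ ‖z‖ + ‖w - z‖ := norm_add_le _ _
      _ < 1 := by linarith

/-- The mean value property of polynomials for rotation invariant mollifiers. -/
lemma Mollifier.integral_pow_mul (ρ : Mollifier) {ε : ℝ} (hε : 0 < ε) (z : ℂ) (n : ℕ) :
    ∫ w, w ^ n * ((ρ.density ε z).toFun w : ℂ) = z ^ n := by
  have hi : ∀ k : ℕ, Integrable fun v : ℂ => v ^ k * (ρ.toFun v : ℂ) := fun k => by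
    refine Continuous.integrable_of_hasCompactSupport ?_
      ((ρ.compact_support.comp_left (g := fun x : ℝ => (x : ℂ)) (by simp)).mul_left)
    have := ρ.smooth.continuous
    fun_prop
  have hk : ∀ k : ℕ, ∫ v : ℂ, v ^ k * (ρ.toFun v : ℂ) = if k = 0 then 1 else 0 := fun k => by
    split_ifs with h
    · subst h
      simp_rw [pow_zero, one_mul]
      rw [integral_complex_ofReal, ρ.integral_eq_one, Complex.ofReal_one]
    · simpa using integral_pow_mul_conj_pow_eq_zero ρ.rotation_invariant h
  let G : ℂ → ℂ := fun v => (z - (ε : ℂ) * v) ^ n * (ρ.toFun v : ℂ)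
  have h1 : ∀ w, w ^ n * ((ρ.density ε z).toFun w : ℂ)
      = ((ε ^ 2)⁻¹ : ℝ) • G ((ε⁻¹ : ℝ) • (z - w)) := fun w => by
    have hεc : (ε : ℂ) ≠ 0 := by exact_mod_cast hε.ne'
    have : z - (ε : ℂ) * ((ε⁻¹ : ℝ) • (z - w)) = w := by
      rw [Complex.real_smul]
      push_cast
      field_simp
      ring
    simp only [G]
    rw [this, ρ.density_apply]
    simp only [Complex.real_smul]
    push_cast
    ring
  have h2 : ∫ v, G v = z ^ n := by
    have hexp : ∀ v, G v = ∑ m ∈ Finset.range (n + 1),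
        ((-(ε : ℂ)) ^ m * z ^ (n - m) * (n.choose m : ℂ)) * (v ^ m * (ρ.toFun v : ℂ)) := fun v => by
      simp only [G]
      rw [sub_eq_neg_add, ← neg_mul, add_pow, Finset.sum_mul]
      refine Finset.sum_congr rfl fun m _ => ?_
      rw [mul_pow]
      ring
    simp_rw [hexp]
    rw [integral_finsetSum _ fun m _ => (hi m).const_mul _, Finset.sum_eq_single 0]
    · rw [integral_const_mul, hk]
      simp
    · intro m _ hm
      rw [integral_const_mul, hk, if_neg hm, mul_zero]
    · simp
  simp_rw [h1]
  rw [integral_smul, integral_sub_left_eq_self (fun w : ℂ => G ((ε⁻¹ : ℝ) • w)) volume z,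
    Measure.integral_comp_smul, h2, Complex.finrank_real_complex, smul_smul, inv_pow, inv_inv,
    abs_of_nonneg (by positivity), inv_mul_cancel₀ (by positivity), one_smul]

lemma modeCov_pow {z : ℂ} (hz : ‖z‖ < 1) :
    modeCov (fun n => z ^ (n : ℕ)) (fun n => z ^ (n : ℕ)) = -Real.log (1 - ‖z‖ ^ 2) := by
  have h := hasSum_neg_log_norm hz hz
  have hn : ‖1 - z * conj z‖ = 1 - ‖z‖ ^ 2 := by
    rw [Complex.mul_conj, Complex.normSq_eq_norm_sq, ← Complex.ofReal_one, ← Complex.ofReal_sub,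
      Complex.norm_real, Real.norm_of_nonneg]
    nlinarith [norm_nonneg z]
  rw [hn] at h
  rw [← h.tsum_eq]
  refine tsum_congr fun n => ?_
  rw [div_mul_eq_mul_div, map_pow, ← Complex.ofReal_natCast, Complex.div_ofReal_re]

lemma integral_harmonicExt_sq {z : ℂ} (hz : ‖z‖ < 1) :
    ∫ b, harmonicExt b z ^ 2 ∂circleMeasure = -Real.log (1 - ‖z‖ ^ 2) := by
  rw [← modeCov_pow hz, ← integral_modeSum_sq (geometricDecay_pow hz)]
  refine integral_congr_ae ?_
  filter_upwards [ae_modesSummable] with b hb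
  rw [hb.harmonicExt_eq hz]

lemma wickExp_eq (α : ℂ) {z : ℂ} (hz : ‖z‖ < 1) (a : CircleModes) :
    wickExp α z a = ((1 - ‖z‖ ^ 2 : ℝ) : ℂ) ^ (α ^ 2 / 2)
      * Complex.exp (α * (harmonicExt a z : ℂ)) := by
  have hpos : 0 < 1 - ‖z‖ ^ 2 := by nlinarith [norm_nonneg z]
  rw [wickExp, integral_harmonicExt_sq hz,
    Complex.cpow_def_of_ne_zero (by exact_mod_cast hpos.ne'), ← Complex.exp_add,
    ← Complex.ofReal_log hpos.le]
  congr 1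
  push_cast
  ring

variable {Ω Ω' : Type*} [MeasurableSpace Ω] [MeasurableSpace Ω'] {μ : Measure Ω}
  {μD : Measure Ω'} {Φ : Ω → Config} {ΦD : Ω' → Config}

lemma measurable_vertex (α : ℂ) (ρ : Mollifier) {ε : ℝ} {z : ℂ}
    (hs : tsupport (ρ.density ε z).toFun ⊆ disc) :
    Measurable[fieldSigma disc] (vertex μ Φ ρ α ε z) :=
  measurable_fieldSigma_disc_iff.2
    ⟨fun v => Complex.exp (α * (v ⟨_, hs⟩ : ℂ)
      - α ^ 2 / 2 * ((∫ x, Φ x (ρ.density ε z) ^ 2 ∂μ : ℝ) : ℂ)), by fun_prop, rfl⟩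

/-- When the mollifier is supported in the disc, the mollified vertex operator is integrable
against the Dirichlet field and its image under `U` is exactly the limit. -/
lemma UMap_vertex (hΦ : IsFreeField μ Φ) (hΦD : IsDirichletField μD ΦD) (Q : ℝ) (α : ℂ)
    (ρ : Mollifier) {ε : ℝ} (hε : 0 < ε) {z : ℂ} (hz : ‖z‖ < 1)
    (hs : tsupport (ρ.density ε z).toFun ⊆ disc) {p : ℝ × CircleModes}
    (hp : ModesSummable p.2) :
    Integrable (fun x => vertex μ Φ ρ α ε z (discField p (ΦD x))) μD ∧
      UMap Q μD ΦD (vertex μ Φ ρ α ε z) p = Complex.exp ((α - Q) * p.1) * wickExp α z p.2 := by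
  set f : DiscDensity := ⟨ρ.density ε z, hs⟩ with hf
  have hmom : moment f.1 = fun n : ℕ+ => z ^ (n : ℕ) := funext fun n => ρ.integral_pow_mul hε z n
  have hmass : mass f.1 = 1 := by
    have h := ρ.integral_pow_mul hε z 0
    simp_rw [pow_zero, one_mul] at h
    rw [integral_complex_ofReal] at h
    exact_mod_cast h
  obtain ⟨hv0, hv⟩ := hΦD.map_sum (fun _ : Unit => f.1) {()} fun _ => 1
  simp only [Finset.sum_singleton, one_mul, quadForm] at hv0 hv
  have hvar : ∫ x, Φ x f.1 ^ 2 ∂μ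
      = (∫ z in disc, ∫ w in disc, greenDisc z w * f.1.toFun z * f.1.toFun w)
        + -Real.log (1 - ‖z‖ ^ 2) := by
    simp_rw [sq]
    rw [hΦ.covariance_eq, sphereCov_inside, hmom, modeCov_pow hz, sq]
  set V := ∫ z in disc, ∫ w in disc, greenDisc z w * f.1.toFun z * f.1.toFun w
  have hF : ∀ x, vertex μ Φ ρ α ε z (discField p (ΦD x))
      = Complex.exp (α * (p.1 + harmonicExt p.2 z : ℝ)
          - α ^ 2 / 2 * ((V + -Real.log (1 - ‖z‖ ^ 2) : ℝ) : ℂ))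
        * Complex.exp (α * (ΦD x f.1 : ℂ)) := fun x => by
    have h := discField_apply hp (ΦD x) f
    rw [hmass, mul_one, hmom, ← hp.harmonicExt_eq hz] at h
    rw [vertex, ← Complex.exp_add]
    change Complex.exp (α * (discField p (ΦD x) f.1 : ℂ)
      - α ^ 2 / 2 * ((∫ x, Φ x f.1 ^ 2 ∂μ : ℝ) : ℂ)) = _
    rw [h, hvar]
    congr 1
    push_cast
    ring
  constructor
  · simp_rw [hF]
    exact (integrable_cexp_mul (hΦD.measurable_eval f.1).aemeasurable hv α).const_mul _
  · rw [UMap]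
    simp_rw [hF]
    rw [integral_const_mul, integral_cexp_mul hv, Real.coe_toNNReal _ hv0, wickExp,
      integral_harmonicExt_sq hz, Complex.ofReal_exp, ← Complex.exp_add, ← Complex.exp_add,
      ← Complex.exp_add]
    congr 1
    push_cast
    ring

end Vertex

end QFree

end

theorem proposition6 (Q : ℝ)
    {Ω : Type*} [MeasurableSpace Ω] (μ : Measure Ω) [IsProbabilityMeasure μ]
    (Φ : Ω → QFree.Config) (hΦ : QFree.IsFreeField μ Φ)
    {Ω' : Type*} [MeasurableSpace Ω'] (μD : Measure Ω') [IsProbabilityMeasure μD]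
    (ΦD : Ω' → QFree.Config) (hΦD : QFree.IsDirichletField μD ΦD) :
    -- the functionals form a vector space, on which `(F, G) = ⟨(Θ F) G⟩` converges and is a
    -- positive semidefinite Hermitian form, and `U` extends to a unitary map of the completion
    (∃ (D : Submodule ℂ (QFree.Config → ℂ)) (core : PreInnerProductSpace.Core ℂ D),
      (D : Set (QFree.Config → ℂ)) = QFree.osDomain Q μ Φ ∧
      (∀ F G : D, QFree.FreeIntegrable Q μ Φ
        fun φ => QFree.Theta Q (F : QFree.Config → ℂ) φ * (G : QFree.Config → ℂ) φ) ∧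
      (∀ F G : D, core.inner F G = QFree.osForm Q μ Φ F G) ∧
      (∀ F : D,
        (∀ᵐ p ∂QFree.targetMeasure,
          Integrable (fun x => (F : QFree.Config → ℂ) (QFree.discField p (ΦD x))) μD) ∧
        MemLp (QFree.UMap Q μD ΦD F) 2 QFree.targetMeasure) ∧
      ∃ U : QFree.HilbertCompletion core ≃ₗᵢ[ℂ] Lp ℂ 2 QFree.targetMeasure,
        ∀ F : D, U (QFree.toHilbert core F) =ᵐ[QFree.targetMeasure] QFree.UMap Q μD ΦD F) ∧
    -- the image of the vertex operators, as the limit of the mollified ones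
    (∀ (ρ : QFree.Mollifier) (α : ℂ), ∀ z ∈ QFree.disc,
      (∀ᶠ ε in 𝓝[>] (0 : ℝ),
        Measurable[QFree.fieldSigma QFree.disc] (QFree.vertex μ Φ ρ α ε z) ∧
        ∀ᵐ p ∂QFree.targetMeasure,
          Integrable (fun x => QFree.vertex μ Φ ρ α ε z (QFree.discField p (ΦD x))) μD) ∧
      (∀ᵐ p ∂QFree.targetMeasure,
        Tendsto (fun ε : ℝ => QFree.UMap Q μD ΦD (QFree.vertex μ Φ ρ α ε z) p) (𝓝[>] 0)
          (𝓝 (Complex.exp ((α - Q) * p.1) * QFree.wickExp α z p.2))) ∧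
      (∀ R : ℝ,
        Tendsto (fun ε : ℝ => eLpNorm
            (fun p => QFree.UMap Q μD ΦD (QFree.vertex μ Φ ρ α ε z) p
              - Complex.exp ((α - Q) * p.1) * QFree.wickExp α z p.2) 2
            (QFree.targetMeasure.restrict (Set.Icc (-R) R ×ˢ Set.univ)))
          (𝓝[>] 0) (𝓝 0)) ∧
      (∀ a : QFree.CircleModes, QFree.wickExp α z a =
        ((1 - ‖z‖ ^ 2 : ℝ) : ℂ) ^ (α ^ 2 / 2) * Complex.exp (α * (QFree.harmonicExt a z : ℂ)))) := by
  refine ⟨⟨QFree.osSubmodule hΦ hΦD Q, QFree.pullbackCore (QFree.UMapLp hΦ hΦD Q), rfl,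
    fun F G => QFree.freeIntegrable_of_mem hΦ hΦD F.2 G.2, QFree.inner_UMapLp hΦ hΦD Q,
    fun F => ⟨QFree.ae_integrable_of_mem hΦ hΦD F.2, QFree.memLp_UMap hΦ hΦD F.2⟩, ?_⟩, ?_⟩
  · obtain ⟨U, hU⟩ := QFree.exists_unitary_of_denseRange (QFree.UMapLp hΦ hΦD Q)
      (QFree.denseRange_UMapLp hΦ hΦD Q)
    refine ⟨U, fun F => ?_⟩
    rw [hU F]
    exact (QFree.memLp_UMap hΦ hΦD F.2).coeFn_toLp
  · intro ρ α z hz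
    have hz1 : ‖z‖ < 1 := by simpa using hz
    have hev := (ρ.eventually_tsupport_subset hz).and self_mem_nhdsWithin
    refine ⟨?_, ?_, fun R => ?_, QFree.wickExp_eq α hz1⟩
    · filter_upwards [hev] with ε hε
      refine ⟨QFree.measurable_vertex α ρ hε.1, ?_⟩
      filter_upwards [QFree.ae_target_modesSummable] with p hp
      exact (QFree.UMap_vertex hΦ hΦD Q α ρ hε.2 hz1 hε.1 hp).1
    · filter_upwards [QFree.ae_target_modesSummable] with p hp
      refine tendsto_const_nhds.congr' ?_
      filter_upwards [hev] with ε hε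
      exact (QFree.UMap_vertex hΦ hΦD Q α ρ hε.2 hz1 hε.1 hp).2.symm
    · refine tendsto_const_nhds.congr' ?_
      filter_upwards [hev] with ε hε
      symm
      refine (eLpNorm_congr_ae (g := fun _ => (0 : ℂ)) (ae_restrict_of_ae ?_)).trans
        eLpNorm_zero'
      filter_upwards [QFree.ae_target_modesSummable] with p hp
      rw [(QFree.UMap_vertex hΦ hΦD Q α ρ hε.2 hz1 hε.1 hp).2, sub_self]
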